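/- Let $\mathbb D$ be the open unit disk of $\mathbb C$, $\mathbb T$ the unit circle, and $\mathcal P(\mathbb T)$ the set of Borel probability measures on $\mathbb T$ with the topology of weak convergence. For even $N\ge 2$ and $\alpha_1,\dots,\alpha_N\in\overline{\mathbb D}$ put $\rho_j=\sqrt{1-|\alpha_j|^2}$ and $\Xi_j=\begin{pmatrix}\overline{\alpha_j}&\rho_j\\ \rho_j&-\alpha_j\end{pmatrix}$. Let $\mathcal E=\mathcal L\mathcal M$, where $\mathcal L=\mathrm{diag}(\Xi_1,\Xi_3,\dots,\Xi_{N-1})$ and $\mathcal M$ is the $N\times N$ matrix with the blocks $\Xi_2,\Xi_4,\dots,\Xi_{N-2}$ on the rows and columns $(2,3),(4,5),\dots,(N-2,N-1)$, with corner entries $\mathcal M_{11}=-\alpha_N$, $\mathcal M_{1N}=\mathcal M_{N1}=\rho_N$, $\mathcal M_{NN}=\overline{\alpha_N}$, and with all other entries $0$. The matrix $\mathcal E$ is unitary; let $e^{i\theta_1},\dots,e^{i\theta_N}$ be its eigenvalues, with multiplicity, and let $\mu_N(\mathcal E)=\frac1N\sum_{j=1}^N\delta_{e^{i\theta_j}}$.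 For $\beta>0$ and $V:\mathbb T\to\mathbb R$ continuous, let $\mathbb P^{V,\beta}_{AL,N}$ be the probability measure on $\mathbb D^N$ $$d\mathbb P^{V,\beta}_{AL,N}=\frac1{Z_N(V,\beta)}\prod_{j=1}^N(1-|\alpha_j|^2)^{\beta-1}\,\mathbf 1_{\{\alpha_j\in\mathbb D\}}\,e^{-\mathrm{Tr}\,V(\mathcal E)}\,d^2\alpha,\qquad \mathrm{Tr}\,V(\mathcal E)=\sum_{j=1}^N V(e^{i\theta_j}),$$ where $Z_N(V,\beta)$ is the normalising constant. For $\nu>1$, let $\Theta_\nu$ be the law on $\overline{\mathbb D}$ with density $\frac{\nu-1}{2\pi}(1-|z|^2)^{(\nu-3)/2}$ with respect to Lebesgue measure. A function $J:\mathcal P(\mathbb T)\to[0,+\infty]$ is a good rate function if $\{J\le a\}$ is compact for all $a\ge 0$. The sequence $(\mu_N(\mathcal E))_{N\text{ even}}$ satisfies a large deviations principle (LDP) with rate function $J$, under laws $\mathbb P_N$ of $(\alpha_1,\dots,\alpha_N)$, if for all open $O$ and all closed $F$ in $\mathcal P(\mathbb T)$ $$-\inf_O J\le\liminf_{N\text{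 even}}\frac1N\ln\mathbb P_N(\mu_N(\mathcal E)\in O),\qquad \limsup_{N\text{ even}}\frac1N\ln\mathbb P_N(\mu_N(\mathcal E)\in F)\le-\inf_F J.$$ **Corollary.** Let $\beta>0$. Under $\mathbb P^{0,\beta}_{AL,N}$ the $\alpha_j$ are i.i.d. with law $\Theta_{2\beta+1}$, and for such coefficients $(\mu_N(\mathcal E))_{N\text{ even}}$ satisfies an LDP with a good convex rate function $J_\beta$, which is the only good rate function with this property. For every continuous $V:\mathbb T\to\mathbb R$, the sequence $(\mu_N(\mathcal E))_{N\text{ even}}$ satisfies, under $\mathbb P^{V,\beta}_{AL,N}$, an LDP with the good convex rate function $$J_\beta^V(\mu)=g_\beta^V(\mu)-\inf_{\nu\in\mathcal P(\mathbb T)}g_\beta^V(\nu),\qquad g_\beta^V(\mu)=J_\beta(\mu)+\int_{\mathbb T}V\,d\mu .$$ -/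

import Mathlib

open MeasureTheory Filter Topology
open scoped ENNReal NNReal ComplexConjugate

noncomputable section

namespace AblowitzLadik

/-- The unit circle carries its Borel σ-algebra. -/
instance circleMeasurableSpace : MeasurableSpace Circle := borel Circle

instance circleBorelSpace : BorelSpace Circle := ⟨rfl⟩

/-! ### Large deviations principles -/

/-- A good rate function: it takes values in `[0, +∞]` and its sublevel sets are compact. -/
structure IsGoodRateFunction {X : Type*} [TopologicalSpace X] (I : X → EReal) : Prop where
  nonneg : ∀ x, 0 ≤ I x
  isCompact_sublevel : ∀ a : ℝ, 0 ≤ a → IsCompact {x | I x ≤ (a : EReal)}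

/-- The random elements `Y N : Ω N → X`, under the laws `P N`, satisfy a large deviations principle
at speed `N`, as `N → ∞` along the even integers, with rate function `I`.
Here `ENNReal.log 0 = -∞`, and the infimum over the empty set is `+∞`. -/
structure SatisfiesLDP {X : Type*} [TopologicalSpace X] {Ω : ℕ → Type*}
    [∀ N, MeasurableSpace (Ω N)] (P : ∀ N, Measure (Ω N)) (Y : ∀ N, Ω N → X)
    (I : X → EReal) : Prop where
  lower : ∀ O : Set X, IsOpen O →
    -(⨅ x ∈ O, I x) ≤
      liminf (fun N : ℕ => ENNReal.log (P N (Y N ⁻¹' O)) / (N : EReal))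
        (atTop ⊓ 𝓟 {N : ℕ | Even N})
  upper : ∀ F : Set X, IsClosed F →
    limsup (fun N : ℕ => ENNReal.log (P N (Y N ⁻¹' F)) / (N : EReal))
        (atTop ⊓ 𝓟 {N : ℕ | Even N}) ≤
      -(⨅ x ∈ F, I x)

/-- Convexity of an extended-real function of a probability measure. -/
def IsConvexOnProb {X : Type*} [MeasurableSpace X] (I : ProbabilityMeasure X → EReal) : Prop :=
  ∀ (μ ν κ : ProbabilityMeasure X) (a b : ℝ≥0), a + b = 1 →
    (κ : Measure X) = a • (μ : Measure X) + b • (ν : Measure X) →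
    I κ ≤ ((a : ℝ) : EReal) * I μ + ((b : ℝ) : EReal) * I ν

/-! ### The Lax matrix

The coefficients `α_1, …, α_N` are `α 0, …, α (N - 1)`; the row and column indices are shifted in
the same way. Only even `N` is meaningful. -/

/-- `ρ = √(1 - |α|²)`. -/
def rho (z : ℂ) : ℝ := Real.sqrt (1 - ‖z‖ ^ 2)

/-- The `2 × 2` matrix `Ξ(α_j)`, placed on the rows and columns `j` and `j + 1` (cyclically,
`finRotate N` being the cyclic successor on `Fin N`). -/
def xiBlock {N : ℕ} (α : Fin N → ℂ) (j : Fin N) : Matrix (Fin N) (Fin N) ℂ :=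
  Matrix.single j j (conj (α j)) +
  Matrix.single j (finRotate N j) (rho (α j) : ℂ) +
  Matrix.single (finRotate N j) j (rho (α j) : ℂ) +
  Matrix.single (finRotate N j) (finRotate N j) (-(α j))

/-- `L = diag(Ξ_1, Ξ_3, …, Ξ_{N-1})`. -/
def matL {N : ℕ} (α : Fin N → ℂ) : Matrix (Fin N) (Fin N) ℂ :=
  ∑ j : Fin N with Even j.val, xiBlock α j

/-- `M`, made of the blocks `Ξ_2, Ξ_4, …, Ξ_{N-2}` and of `Ξ_N` on the rows and columns `N, 1`. -/
def matM {N : ℕ} (α : Fin N → ℂ) : Matrix (Fin N) (Fin N) ℂ :=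
  ∑ j : Fin N with Odd j.val, xiBlock α j

/-- The Lax matrix (a periodic CMV matrix) `E = L M`. -/
def laxMatrix {N : ℕ} (α : Fin N → ℂ) : Matrix (Fin N) (Fin N) ℂ :=
  matL α * matM α

/-! ### Eigenvalues, traces and empirical measures -/

/-- The eigenvalues `e^{iθ_1}, …, e^{iθ_N}`, with algebraic multiplicity, of a unitary matrix, as
points of the unit circle; `θ_j` is the argument of the `j`-th eigenvalue. -/
def circleEigenvalues {N : ℕ} (A : Matrix (Fin N) (Fin N) ℂ) : Multiset Circle :=
  A.charpoly.roots.map fun z => Circle.exp z.arg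

lemma card_circleEigenvalues {N : ℕ} (A : Matrix (Fin N) (Fin N) ℂ) :
    (circleEigenvalues A).card = N := by
  rw [circleEigenvalues, Multiset.card_map,
    IsAlgClosed.card_roots_eq_natDegree]
  simp [Matrix.charpoly_natDegree_eq_dim]

/-- `Tr V(A) = ∑_j V(e^{iθ_j})` for a unitary matrix `A` with eigenvalues `e^{iθ_j}`: the matrix
`V(A)` is `U diag(V(e^{iθ_j})) U*` if `A = U diag(e^{iθ_j}) U*`. -/
def traceFun {N : ℕ} (V : Circle → ℝ) (A : Matrix (Fin N) (Fin N) ℂ) : ℝ :=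
  ((circleEigenvalues A).map V).sum

/-- `(1/N) ∑_j δ_{e^{iθ_j}}`, as a measure on the circle. -/
def eigenvalueMeasure {N : ℕ} (A : Matrix (Fin N) (Fin N) ℂ) : Measure Circle :=
  (N : ℝ≥0∞)⁻¹ • ((circleEigenvalues A).map fun z => Measure.dirac z).sum

lemma isProbabilityMeasure_eigenvalueMeasure {N : ℕ} (hN : N ≠ 0)
    (A : Matrix (Fin N) (Fin N) ℂ) : IsProbabilityMeasure (eigenvalueMeasure A) := by
  have key : ∀ s : Multiset Circle,
      ((s.map fun z => (Measure.dirac z : Measure Circle)).sum) Set.univ = (s.card : ℝ≥0∞) := by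
    intro s
    induction s using Multiset.induction_on with
    | empty => simp
    | cons a s ih => simp [ih, add_comm]
  constructor
  rw [eigenvalueMeasure, Measure.smul_apply, key, card_circleEigenvalues, smul_eq_mul]
  exact ENNReal.inv_mul_cancel (by exact_mod_cast hN) (by simp)

/-- The empirical measure of the eigenvalues, as a probability measure on the circle (the value for
`N = 0` is irrelevant). -/
def empiricalMeasure {N : ℕ} (A : Matrix (Fin N) (Fin N) ℂ) : ProbabilityMeasure Circle :=
  if hN : N ≠ 0 then ⟨eigenvalueMeasure A, isProbabilityMeasure_eigenvalueMeasure hN A⟩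
  else ⟨Measure.dirac 1, inferInstance⟩

/-! ### The laws of the coefficients -/

/-- The law `Θ_ν` (for `ν > 1`) on the closed unit disk: its density with respect to the Lebesgue
measure of the plane is `(ν - 1) / (2π) · (1 - |z|²)^{(ν - 3) / 2}`. -/
def thetaLaw (ν : ℝ) : Measure ℂ :=
  (volume.restrict (Metric.closedBall (0 : ℂ) 1)).withDensity fun z =>
    ENNReal.ofReal ((ν - 1) / (2 * Real.pi) * (1 - ‖z‖ ^ 2) ^ ((ν - 3) / 2))

/-- The law of `N` independent coefficients with law `Θ_{2β+1}`. -/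
def iidLaw (β : ℝ) (N : ℕ) : Measure (Fin N → ℂ) :=
  Measure.pi fun _ => thetaLaw (2 * β + 1)

/-- The unnormalised Gibbs measure
`∏_j (1 - |α_j|²)^{β-1} 1_{|α_j| < 1} exp(-Tr V(E)) d²α`. -/
def gibbsUnnormalised (β : ℝ) (V : Circle → ℝ) (N : ℕ) : Measure (Fin N → ℂ) :=
  (volume.restrict {α : Fin N → ℂ | ∀ j, ‖α j‖ < 1}).withDensity fun α =>
    ENNReal.ofReal ((∏ j, (1 - ‖α j‖ ^ 2) ^ (β - 1)) *
      Real.exp (-traceFun V (laxMatrix α)))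

/-- The partition function `Z_N(V, β)`. -/
def partitionFunction (β : ℝ) (V : Circle → ℝ) (N : ℕ) : ℝ≥0∞ :=
  gibbsUnnormalised β V N Set.univ

/-- The generalised Gibbs ensemble of the Ablowitz–Ladik lattice. -/
def gibbs (β : ℝ) (V : Circle → ℝ) (N : ℕ) : Measure (Fin N → ℂ) :=
  (partitionFunction β V N)⁻¹ • gibbsUnnormalised β V N

/-! ### The rate function with potential -/

/-- `g(μ) = J(μ) + ∫ V dμ`. -/
def freeEnergy (J : ProbabilityMeasure Circle → EReal) (V : Circle → ℝ)
    (μ : ProbabilityMeasure Circle) : EReal :=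
  J μ + ((∫ z, V z ∂(μ : Measure Circle) : ℝ) : EReal)

/-- `J^V(μ) = g(μ) - inf_ν g(ν)`. -/
def tiltedRate (J : ProbabilityMeasure Circle → EReal) (V : Circle → ℝ)
    (μ : ProbabilityMeasure Circle) : EReal :=
  freeEnergy J V μ - ⨅ ν, freeEnergy J V ν

end AblowitzLadik

end

/-!
The proof identifies a measure on the circle with its moments `m_k(μ) = ∫ z ^ k dμ`, `k ≥ 0`, which
are continuous, bounded by `1`, and separate the points of the compact space of probability measures
(`eq_of_circleMoment_eq`). For a unitary matrix, `N m_k` of the empirical measure is the trace of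
the `k`-th power (`natCast_mul_circleMoment`).

The heart of the matter is locality. For even `N` and `M`, the Lax matrix of a concatenation of `N`
and `M` coefficients differs from the direct sum of the two Lax matrices in boundedly many entries,
so that the traces of the `k`-th powers add up to within `16 k`
(`norm_trace_laxMatrix_append_pow_sub_le`). With independent coefficients this makes the
probabilities of the neighbourhoods `{ν | ∀ k, |m_k ν - m_k μ| ≤ r (k + 1)}` supermultiplicative, up
to an error in the radius that is negligible for large sizes (`isSuperadditive_iidLaw`). Hence the
exponential decay rates of these probabilities exist
(`IsSuperadditive.eventually_le_of_frequently_le`), and they are convex because a system of size `N`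
splits into parts of sizes about `a N` and `b N` (`IsSuperadditive.convex`).

On a compact space such a local rate is lower semicontinuous and governs all open and closed sets
(`IsLocalRate.satisfiesLDP`), and conversely a good rate function of a large deviations principle
is the local rate (`SatisfiesLDP.isLocalRate`), whence uniqueness. The potential multiplies the law
by `exp (-N ∫ V dμ)`, up to normalisation. It therefore adds `∫ V dμ` to the local rate
(`IsLocalRate.tilt`), and normalising subtracts the infimum (`IsLocalRate.normalise`).
-/

namespace AblowitzLadik

/-! ### Local rates and large deviations on compact spaces -/

/-- The filter along which the large deviations principles are stated: `N → ∞` with `N` even. -/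
abbrev evenAtTop : Filter ℕ := atTop ⊓ 𝓟 {N : ℕ | Even N}

instance : evenAtTop.NeBot := by
  refine inf_principal_neBot_iff.2 fun U hU => ?_
  obtain ⟨a, ha⟩ := mem_atTop_sets.1 hU
  exact ⟨2 * a, ha _ (by lia), even_two_mul a⟩

lemma eventually_even : ∀ᶠ N in evenAtTop, Even N :=
  mem_inf_of_right (mem_principal_self _)

lemma eventually_evenAtTop_of_atTop {p : ℕ → Prop} (h : ∀ᶠ N in atTop, p N) :
    ∀ᶠ N in evenAtTop, p N := h.filter_mono inf_le_left

lemma neg_le_log_div_iff {s : ℝ} {N : ℕ} (hN : 0 < N) {p : ℝ≥0∞} :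
    (-s : EReal) ≤ ENNReal.log p / (N : EReal) ↔ ENNReal.ofReal (Real.exp (-(s * N))) ≤ p := by
  have h0 : (0 : EReal) < (N : EReal) := by exact_mod_cast hN
  rw [EReal.le_div_iff_mul_le h0 (EReal.natCast_ne_top N), ← ENNReal.log_le_log_iff,
    ENNReal.log_ofReal_of_pos (Real.exp_pos _), Real.log_exp, ← neg_mul]
  norm_cast

lemma log_div_le_neg_iff {s : ℝ} {N : ℕ} (hN : 0 < N) {p : ℝ≥0∞} :
    ENNReal.log p / (N : EReal) ≤ (-s : EReal) ↔ p ≤ ENNReal.ofReal (Real.exp (-(s * N))) := by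
  have h0 : (0 : EReal) < (N : EReal) := by exact_mod_cast hN
  rw [EReal.div_le_iff_le_mul h0 (EReal.natCast_ne_top N), ← ENNReal.log_le_log_iff,
    ENNReal.log_ofReal_of_pos (Real.exp_pos _), Real.log_exp,
    show (N : EReal) * -(s : EReal) = ((-(s * N) : ℝ) : EReal) by
      push_cast
      rw [mul_neg, mul_comm]]

lemma ofReal_exp_lt_ofReal_exp {s t : ℝ} (h : s < t) {N : ℕ} (hN : 0 < N) :
    ENNReal.ofReal (Real.exp (-(t * N))) < ENNReal.ofReal (Real.exp (-(s * N))) := by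
  rw [ENNReal.ofReal_lt_ofReal_iff (Real.exp_pos _), Real.exp_lt_exp]
  have : (0 : ℝ) < N := by exact_mod_cast hN
  nlinarith

lemma ofReal_exp_neg_mul_add (s t : ℝ) (N : ℕ) :
    ENNReal.ofReal (Real.exp (-((s + t) * N))) =
      ENNReal.ofReal (Real.exp (-(s * N))) * ENNReal.ofReal (Real.exp (-(t * N))) := by
  rw [← ENNReal.ofReal_mul (Real.exp_pos _).le, ← Real.exp_add]
  ring_nf

lemma ofReal_exp_neg_mul_neg (s : ℝ) (N : ℕ) :
    ENNReal.ofReal (Real.exp (-(-s * N))) = (ENNReal.ofReal (Real.exp (-(s * N))))⁻¹ := by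
  rw [← ENNReal.ofReal_inv_of_pos (Real.exp_pos _), ← Real.exp_neg]
  ring_nf

lemma eventually_natCast_mul_exp_le (n : ℕ) {s t : ℝ} (h : s < t) :
    ∀ᶠ N : ℕ in evenAtTop, (n : ℝ≥0∞) * ENNReal.ofReal (Real.exp (-(t * N))) ≤
      ENNReal.ofReal (Real.exp (-(s * N))) := by
  have h1 : Tendsto (fun N : ℕ => Real.exp ((t - s) * N)) atTop atTop :=
    Real.tendsto_exp_atTop.comp
      (tendsto_natCast_atTop_atTop.const_mul_atTop (sub_pos.2 h))
  refine eventually_evenAtTop_of_atTop ?_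
  filter_upwards [h1.eventually_ge_atTop (n : ℝ)] with N hN
  rw [← ENNReal.ofReal_natCast n, ← ENNReal.ofReal_mul (Nat.cast_nonneg n)]
  refine ENNReal.ofReal_le_ofReal ?_
  calc (n : ℝ) * Real.exp (-(t * N)) ≤ Real.exp ((t - s) * N) * Real.exp (-(t * N)) := by gcongr
    _ = Real.exp (-(s * N)) := by rw [← Real.exp_add]; ring_nf

section LocalRate

variable {X : Type*} [TopologicalSpace X] {Ω : ℕ → Type*} [∀ N, MeasurableSpace (Ω N)]
  {P Q : ∀ N, Measure (Ω N)} {Y : ∀ N, Ω N → X} {I I' : X → EReal}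

/-- `I` is the exponential decay rate, at speed `N`, of the mass which the law of `Y N` gives to
small neighbourhoods of a point: up to subexponential factors, that mass is at least `exp (-N I x)`
for every neighbourhood of `x`, and at most `exp (-N I x)` for small ones. The measures `P N` need
not have mass one. -/
structure IsLocalRate (P : ∀ N, Measure (Ω N)) (Y : ∀ N, Ω N → X) (I : X → EReal) : Prop where
  lower : ∀ x, ∀ s : ℝ, I x < s → ∀ U ∈ 𝓝 x,
    ∀ᶠ N : ℕ in evenAtTop, ENNReal.ofReal (Real.exp (-(s * N))) ≤ P N (Y N ⁻¹' U)
  upper : ∀ x, ∀ s : ℝ, s < I x → ∃ U ∈ 𝓝 x,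
    ∀ᶠ N : ℕ in evenAtTop, P N (Y N ⁻¹' U) ≤ ENNReal.ofReal (Real.exp (-(s * N)))

lemma eventually_pos : ∀ᶠ N : ℕ in evenAtTop, 0 < N :=
  eventually_evenAtTop_of_atTop (eventually_gt_atTop 0)

/-- On a compact space the local rate governs all open and closed sets: a closed set is covered by
finitely many neighbourhoods, and their number does not matter on the exponential scale. -/
theorem IsLocalRate.satisfiesLDP [CompactSpace X] (h : IsLocalRate P Y I) :
    SatisfiesLDP P Y I where
  lower O hO := by
    rw [EReal.neg_le]
    refine le_iInf₂ fun x hx => ?_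
    refine EReal.le_of_forall_lt_iff_le.1 fun s hs => ?_
    rw [EReal.neg_le]
    refine le_liminf_of_le (by isBoundedDefault) ?_
    filter_upwards [h.lower x s hs O (hO.mem_nhds hx), eventually_pos] with N hN h0
    exact (neg_le_log_div_iff h0).2 hN
  upper F hF := by
    rw [EReal.le_neg]
    refine EReal.ge_of_forall_gt_iff_ge.1 fun s hs => ?_
    obtain ⟨t, hst, ht⟩ := EReal.lt_iff_exists_real_btwn.1 hs
    rw [EReal.le_neg]
    have hU : ∀ x, ∃ U ∈ 𝓝 x, x ∈ F → ∀ᶠ N : ℕ in evenAtTop,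
        P N (Y N ⁻¹' U) ≤ ENNReal.ofReal (Real.exp (-(t * N))) := fun x => by
      by_cases hx : x ∈ F
      · obtain ⟨U, hU, h1⟩ := h.upper x t (ht.trans_le (iInf₂_le x hx))
        exact ⟨U, hU, fun _ => h1⟩
      · exact ⟨Set.univ, univ_mem, fun h => absurd h hx⟩
    choose U hU hU' using hU
    obtain ⟨T, hT, hFT⟩ := hF.isCompact.elim_nhds_subcover U fun x _ => hU x
    refine limsup_le_of_le (by isBoundedDefault) ?_
    filter_upwards [(T.eventually_all).2 fun x hx => hU' x (hT x hx), eventually_pos,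
      eventually_natCast_mul_exp_le T.card (EReal.coe_lt_coe_iff.1 hst)] with N hN h0 hc
    refine (log_div_le_neg_iff h0).2 (le_trans ?_ hc)
    calc P N (Y N ⁻¹' F) ≤ P N (⋃ x ∈ T, Y N ⁻¹' U x) := by
          refine measure_mono fun ω hω => ?_
          simpa using hFT hω
      _ ≤ ∑ x ∈ T, P N (Y N ⁻¹' U x) := measure_biUnion_finset_le _ _
      _ ≤ ∑ x ∈ T, ENNReal.ofReal (Real.exp (-(t * N))) := Finset.sum_le_sum hN
      _ = _ := by simp

theorem IsLocalRate.isClosed_sublevel (h : IsLocalRate P Y I) (a : EReal) :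
    IsClosed {x | I x ≤ a} := by
  rw [← isOpen_compl_iff, isOpen_iff_mem_nhds]
  intro x hx
  have hx' : a < I x := not_le.1 hx
  obtain ⟨s, has, hs⟩ := EReal.lt_iff_exists_real_btwn.1 hx'
  obtain ⟨t, hst, ht⟩ := EReal.lt_iff_exists_real_btwn.1 hs
  obtain ⟨U, hU, hN⟩ := h.upper x t ht
  filter_upwards [eventually_mem_nhds_iff.2 hU] with y hy hya
  obtain ⟨N, ⟨h1, h2⟩, h0⟩ :=
    ((hN.and (h.lower y s (lt_of_le_of_lt hya has) U hy)).and eventually_pos).exists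
  exact (ofReal_exp_lt_ofReal_exp (EReal.coe_lt_coe_iff.1 hst) h0).not_ge (h2.trans h1)

theorem IsLocalRate.nonneg [∀ N, IsProbabilityMeasure (P N)] (h : IsLocalRate P Y I) (x : X) :
    0 ≤ I x := by
  by_contra! hx
  obtain ⟨s, hs, hs0⟩ := EReal.lt_iff_exists_real_btwn.1 hx
  obtain ⟨N, h1, h0⟩ := ((h.lower x s hs Set.univ univ_mem).and eventually_pos).exists
  have h2 := ofReal_exp_lt_ofReal_exp (EReal.coe_lt_coe_iff.1 hs0) h0
  have h3 := h2.trans_le (h1.trans prob_le_one)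
  simp at h3

theorem IsLocalRate.isGoodRateFunction [CompactSpace X] (h : IsLocalRate P Y I)
    (h0 : ∀ x, 0 ≤ I x) : IsGoodRateFunction I :=
  ⟨h0, fun a _ => (h.isClosed_sublevel a).isCompact⟩

theorem IsLocalRate.unique (h : IsLocalRate P Y I) (h' : IsLocalRate P Y I') : I = I' := by
  have key : ∀ {I I' : X → EReal}, IsLocalRate P Y I → IsLocalRate P Y I' → ∀ x, I x ≤ I' x := by
    intro I I' h h' x
    by_contra! hx
    obtain ⟨s, h's, hs⟩ := EReal.lt_iff_exists_real_btwn.1 hx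
    obtain ⟨t, hst, ht⟩ := EReal.lt_iff_exists_real_btwn.1 hs
    obtain ⟨U, hU, hN⟩ := h.upper x t ht
    obtain ⟨N, ⟨h1, h2⟩, h0⟩ := ((hN.and (h'.lower x s h's U hU)).and eventually_pos).exists
    exact (ofReal_exp_lt_ofReal_exp (EReal.coe_lt_coe_iff.1 hst) h0).not_ge (h2.trans h1)
  exact funext fun x => le_antisymm (key h h' x) (key h' h x)

/-- A good rate function with which a large deviations principle holds is the local rate: it is
lower semicontinuous, so that its infimum over a small closed neighbourhood of `x` is close to its
value at `x`. -/
theorem SatisfiesLDP.isLocalRate [T2Space X] [CompactSpace X] (h : SatisfiesLDP P Y I)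
    (hI : IsGoodRateFunction I) : IsLocalRate P Y I where
  lower x s hs U hU := by
    obtain ⟨O, hOU, hO, hxO⟩ := mem_nhds_iff.1 hU
    have h1 : (-s : EReal) < liminf (fun N : ℕ => ENNReal.log (P N (Y N ⁻¹' O)) / (N : EReal))
        evenAtTop :=
      (EReal.neg_lt_neg_iff.2 (lt_of_le_of_lt (iInf₂_le x hxO) hs)).trans_le (h.lower O hO)
    filter_upwards [eventually_lt_of_lt_liminf h1, eventually_pos] with N hN h0
    exact ((neg_le_log_div_iff h0).1 hN.le).trans (measure_mono (Set.preimage_mono hOU))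
  upper x s hs := by
    obtain ⟨t, hst, ht⟩ := EReal.lt_iff_exists_real_btwn.1 hs
    have hcl : IsClosed {y | I y ≤ t} := by
      rcases le_or_gt 0 t with h0 | h0
      · exact (hI.isCompact_sublevel t h0).isClosed
      · convert isClosed_empty
        refine Set.eq_empty_of_forall_notMem fun y hy => ?_
        exact absurd ((hI.nonneg y).trans hy) (by simpa using h0)
    obtain ⟨F, hF, hFc, hFt⟩ := exists_mem_nhds_isClosed_subset
      (hcl.isOpen_compl.mem_nhds (show x ∈ {y | I y ≤ t}ᶜ from not_le.2 ht))
    have h1 : limsup (fun N : ℕ => ENNReal.log (P N (Y N ⁻¹' F)) / (N : EReal)) evenAtTop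
        < (-s : EReal) := by
      refine (h.upper F hFc).trans_lt (EReal.neg_lt_neg_iff.2 (hst.trans_le ?_))
      exact le_iInf₂ fun y hy => (not_le.1 (show ¬ I y ≤ t from hFt hy)).le
    refine ⟨F, hF, ?_⟩
    filter_upwards [eventually_lt_of_limsup_lt h1, eventually_pos] with N hN h0
    exact (log_div_le_neg_iff h0).1 hN.le

theorem IsLocalRate.exists_ne_top [CompactSpace X] [∀ N, IsProbabilityMeasure (P N)]
    (h : IsLocalRate P Y I) : ∃ x, I x ≠ ⊤ := by
  by_contra! htop
  have h1 := h.satisfiesLDP.upper Set.univ isClosed_univ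
  simp [htop] at h1

/-- Dividing by the total mass shifts the local rate by its infimum. -/
theorem IsLocalRate.normalise [CompactSpace X] (h : IsLocalRate Q Y I) {c : ℝ}
    (hc : ⨅ x, I x = (c : EReal)) :
    IsLocalRate (fun N => (Q N Set.univ)⁻¹ • Q N) Y (fun x => I x - ⨅ x, I x) := by
  have hL := h.satisfiesLDP.lower Set.univ isOpen_univ
  have hU := h.satisfiesLDP.upper Set.univ isClosed_univ
  simp only [Set.mem_univ, iInf_pos, Set.preimage_univ] at hL hU
  rw [hc] at hL hU ⊢
  have hlow : ∀ s : ℝ, c < s → ∀ᶠ N : ℕ in evenAtTop,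
      ENNReal.ofReal (Real.exp (-(s * N))) ≤ Q N Set.univ := fun s hs => by
    have h1 : (-s : EReal) < -c := EReal.neg_lt_neg_iff.2 (EReal.coe_lt_coe_iff.2 hs)
    filter_upwards [eventually_lt_of_lt_liminf (h1.trans_le hL), eventually_pos] with N hN h0
    exact (neg_le_log_div_iff h0).1 hN.le
  have hupp : ∀ s : ℝ, s < c → ∀ᶠ N : ℕ in evenAtTop,
      Q N Set.univ ≤ ENNReal.ofReal (Real.exp (-(s * N))) := fun s hs => by
    have h1 : (-c : EReal) < -s := EReal.neg_lt_neg_iff.2 (EReal.coe_lt_coe_iff.2 hs)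
    filter_upwards [eventually_lt_of_limsup_lt (hU.trans_lt h1), eventually_pos] with N hN h0
    exact (log_div_le_neg_iff h0).1 hN.le
  constructor
  · intro x s hs U hU
    have hs' : I x < ((s + c : ℝ) : EReal) := by
      rw [EReal.coe_add]
      exact (EReal.sub_lt_iff (by simp) (by simp)).1 hs
    obtain ⟨s', h1, h2⟩ := EReal.lt_iff_exists_real_btwn.1 hs'
    have h2 : s' < s + c := EReal.coe_lt_coe_iff.1 h2
    filter_upwards [h.lower x s' h1 U hU, hupp (s' - s) (by linarith)] with N hN1 hN2
    rw [Measure.smul_apply, smul_eq_mul]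
    calc ENNReal.ofReal (Real.exp (-(s * N)))
        = ENNReal.ofReal (Real.exp (-((-(s' - s) + s') * N))) := by ring_nf
      _ = (ENNReal.ofReal (Real.exp (-((s' - s) * N))))⁻¹ *
            ENNReal.ofReal (Real.exp (-(s' * N))) := by
          rw [ofReal_exp_neg_mul_add, ofReal_exp_neg_mul_neg]
      _ ≤ _ := mul_le_mul' (ENNReal.inv_le_inv.2 hN2) hN1
  · intro x s hs
    have hs' : ((s + c : ℝ) : EReal) < I x := by
      rw [EReal.coe_add]
      exact (EReal.lt_sub_iff_add_lt (by simp) (by simp)).1 hs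
    obtain ⟨s', h1, h2⟩ := EReal.lt_iff_exists_real_btwn.1 hs'
    have h1 : s + c < s' := EReal.coe_lt_coe_iff.1 h1
    obtain ⟨U, hU, hN⟩ := h.upper x s' h2
    refine ⟨U, hU, ?_⟩
    filter_upwards [hN, hlow (s' - s) (by linarith)] with N hN1 hN2
    rw [Measure.smul_apply, smul_eq_mul]
    calc _ ≤ (ENNReal.ofReal (Real.exp (-((s' - s) * N))))⁻¹ *
            ENNReal.ofReal (Real.exp (-(s' * N))) :=
          mul_le_mul' (ENNReal.inv_le_inv.2 hN2) hN1
      _ = ENNReal.ofReal (Real.exp (-((-(s' - s) + s') * N))) := by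
          rw [ofReal_exp_neg_mul_add, ofReal_exp_neg_mul_neg]
      _ = _ := by ring_nf

/-- Varadhan's tilting in local form: if `Q N` has density `exp (-N F (Y N))` with respect to `P N`,
in the sense of the two bounds on a basis `𝓐` of neighbourhoods, then `F` is added to the local
rate. -/
theorem IsLocalRate.tilt (h : IsLocalRate P Y I) {F : X → ℝ} (hF : Continuous F)
    (𝓐 : Set (Set X)) (h𝓐 : ∀ x, ∀ U ∈ 𝓝 x, ∃ A ∈ 𝓐, A ∈ 𝓝 x ∧ A ⊆ U)
    (hlow : ∀ N : ℕ, Even N → ∀ A ∈ 𝓐, ∀ c : ℝ, (∀ y ∈ A, F y ≤ c) →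
      ENNReal.ofReal (Real.exp (-(c * N))) * P N (Y N ⁻¹' A) ≤ Q N (Y N ⁻¹' A))
    (hupp : ∀ N : ℕ, Even N → ∀ A ∈ 𝓐, ∀ c : ℝ, (∀ y ∈ A, c ≤ F y) →
      Q N (Y N ⁻¹' A) ≤ ENNReal.ofReal (Real.exp (-(c * N))) * P N (Y N ⁻¹' A)) :
    IsLocalRate Q Y (fun x => I x + (F x : EReal)) where
  lower x s hs U hU := by
    have hs' : I x < ((s - F x : ℝ) : EReal) := by
      rw [EReal.coe_sub]
      exact (EReal.lt_sub_iff_add_lt (by simp) (by simp)).2 hs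
    obtain ⟨s', h1, h2⟩ := EReal.lt_iff_exists_real_btwn.1 hs'
    have h2 : s' < s - F x := EReal.coe_lt_coe_iff.1 h2
    have hF' : ∀ᶠ y in 𝓝 x, F y < s - s' :=
      hF.continuousAt.eventually_lt continuousAt_const (by linarith)
    obtain ⟨A, hA, hAx, hAU⟩ := h𝓐 x _ (inter_mem hU hF')
    filter_upwards [h.lower x s' h1 A hAx, eventually_even] with N hN hNe
    calc ENNReal.ofReal (Real.exp (-(s * (N : ℕ))))
        = ENNReal.ofReal (Real.exp (-((s - s' + s') * (N : ℕ)))) := by ring_nf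
      _ ≤ ENNReal.ofReal (Real.exp (-((s - s') * N))) * P N (Y N ⁻¹' A) := by
          rw [ofReal_exp_neg_mul_add]
          gcongr
      _ ≤ Q N (Y N ⁻¹' A) := hlow N hNe A hA _ fun y hy => (hAU hy).2.le
      _ ≤ _ := measure_mono (Set.preimage_mono fun y hy => (hAU hy).1)
  upper x s hs := by
    have hs' : ((s - F x : ℝ) : EReal) < I x := by
      rw [EReal.coe_sub]
      exact (EReal.sub_lt_iff (by simp) (by simp)).2 hs
    obtain ⟨s', h1, h2⟩ := EReal.lt_iff_exists_real_btwn.1 hs'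
    have h1 : s - F x < s' := EReal.coe_lt_coe_iff.1 h1
    have hF' : ∀ᶠ y in 𝓝 x, s - s' < F y :=
      continuousAt_const.eventually_lt hF.continuousAt (by linarith)
    obtain ⟨U, hU, hN⟩ := h.upper x s' h2
    obtain ⟨A, hA, hAx, hAU⟩ := h𝓐 x _ (inter_mem hU hF')
    refine ⟨A, hAx, ?_⟩
    filter_upwards [hN, eventually_even] with N hN hNe
    calc Q N (Y N ⁻¹' A) ≤ ENNReal.ofReal (Real.exp (-((s - s') * N))) * P N (Y N ⁻¹' A) :=
          hupp N hNe A hA _ fun y hy => (hAU hy).2.le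
      _ ≤ ENNReal.ofReal (Real.exp (-((s - s') * N))) * ENNReal.ofReal (Real.exp (-(s' * N))) := by
          gcongr
          exact (measure_mono (Set.preimage_mono fun y hy => (hAU hy).1)).trans hN
      _ = ENNReal.ofReal (Real.exp (-(s * N))) := by
          rw [← ofReal_exp_neg_mul_add]; ring_nf

end LocalRate

/-! ### Superadditivity and the existence of local rates -/

section Superadditive

variable {X : Type*} {Ω : ℕ → Type*} {Y : ∀ N, Ω N → X} {m : ℕ → X → ℂ}

/-- The points whose moments `m k` are within `r (k + 1)` of those of `x`. If `|m k| ≤ 1`, only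
finitely many of these conditions are not void. -/
def momentNhd (m : ℕ → X → ℂ) (x : X) (r : ℝ) : Set X :=
  {y | ∀ k : ℕ, ‖m k y - m k x‖ ≤ r * (k + 1)}

/-- The event that the extensive moments `N m_k(Y N)` are within `a (k + 1)` of `u k`. -/
def momentEvent (Y : ∀ N, Ω N → X) (m : ℕ → X → ℂ) (N : ℕ) (u : ℕ → ℂ) (a : ℝ) : Set (Ω N) :=
  {ω | ∀ k : ℕ, ‖(N : ℂ) * m k (Y N ω) - u k‖ ≤ a * (k + 1)}

lemma momentNhd_mono (x : X) {r r' : ℝ} (h : r ≤ r') : momentNhd m x r ⊆ momentNhd m x r' :=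
  fun _ hy k => (hy k).trans (by gcongr)

lemma preimage_momentNhd {N : ℕ} (hN : 0 < N) (x : X) (r : ℝ) :
    Y N ⁻¹' momentNhd m x r = momentEvent Y m N (fun k => N * m k x) (N * r) := by
  have hN' : (0 : ℝ) < N := by exact_mod_cast hN
  ext ω
  refine forall_congr' fun k => ?_
  rw [← mul_sub, norm_mul, Complex.norm_natCast, mul_assoc, mul_le_mul_iff_right₀ hN']

lemma momentEvent_subset {N : ℕ} {u v : ℕ → ℂ} {a b d : ℝ}
    (huv : ∀ k : ℕ, ‖u k - v k‖ ≤ d * (k + 1)) (h : a + d ≤ b) :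
    momentEvent Y m N u a ⊆ momentEvent Y m N v b := fun ω hω k =>
  calc ‖(N : ℂ) * m k (Y N ω) - v k‖
      ≤ ‖(N : ℂ) * m k (Y N ω) - u k‖ + ‖u k - v k‖ := by
        rw [← sub_add_sub_cancel _ (u k)]; exact norm_add_le _ _
    _ ≤ a * (k + 1) + d * (k + 1) := add_le_add (hω k) (huv k)
    _ ≤ b * (k + 1) := by rw [← add_mul]; gcongr

lemma momentEvent_two_mul (hb : ∀ k x, ‖m k x‖ ≤ 1) (N : ℕ) (x : X) :
    momentEvent Y m N (fun k => N * m k x) (2 * N) = Set.univ := by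
  refine Set.eq_univ_of_forall fun ω k => ?_
  rw [← mul_sub, norm_mul, Complex.norm_natCast]
  have h1 : ‖m k (Y N ω) - m k x‖ ≤ 2 :=
    (norm_sub_le _ _).trans (by linarith [hb k (Y N ω), hb k x])
  have h2 : (0 : ℝ) ≤ k := Nat.cast_nonneg k
  have h3 : (0 : ℝ) ≤ N := Nat.cast_nonneg N
  nlinarith [mul_le_mul_of_nonneg_left h1 h3, mul_nonneg h3 h2]

variable [∀ N, MeasurableSpace (Ω N)] {P : ∀ N, Measure (Ω N)} {C : ℝ}

/-- Superadditivity up to the additive error `C`: what the extensive moments do at sizes `N` and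
`M` independently, they do at size `N + M` with at least the product probability. -/
def IsSuperadditive (P : ∀ N, Measure (Ω N)) (Y : ∀ N, Ω N → X) (m : ℕ → X → ℂ) (C : ℝ) : Prop :=
  ∀ N M : ℕ, Even N → Even M → ∀ (u v : ℕ → ℂ) (a b : ℝ),
    P N (momentEvent Y m N u a) * P M (momentEvent Y m M v b) ≤
      P (N + M) (momentEvent Y m (N + M) (fun k => u k + v k) (a + b + C))

/-- A system of size `q n + t` contains `q` independent systems of size `n`; the remainder of size
`t` is not constrained. -/
lemma IsSuperadditive.pow_le [∀ N, IsProbabilityMeasure (P N)] (h : IsSuperadditive P Y m C)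
    (hb : ∀ k x, ‖m k x‖ ≤ 1) {n t : ℕ} (hn : Even n) (ht : Even t) (x : X) (a : ℝ) (q : ℕ) :
    P n (momentEvent Y m n (fun k => n * m k x) a) ^ q ≤
      P (n * q + t) (momentEvent Y m (n * q + t) (fun k => (n * q + t : ℕ) * m k x)
        (q * (a + C) + 2 * t)) := by
  induction q with
  | zero =>
    have e : n * 0 + t = t := by ring
    rw [e, pow_zero, Nat.cast_zero, zero_mul, zero_add, momentEvent_two_mul hb, measure_univ]
  | succ q ih =>
    have h1 := h n (n * q + t) hn ((hn.mul_right q).add ht) (fun k => n * m k x)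
      (fun k => (n * q + t : ℕ) * m k x) a (q * (a + C) + 2 * t)
    rw [pow_succ']
    refine (mul_le_mul' le_rfl ih).trans (h1.trans ?_)
    have e : n * (q + 1) + t = n + (n * q + t) := by ring
    rw [e]
    refine measure_mono (momentEvent_subset (d := 0) (fun k => ?_) (by push_cast; linarith))
    have : (n : ℂ) * m k x + (n * q + t : ℕ) * m k x - (n + (n * q + t) : ℕ) * m k x = 0 := by
      push_cast; ring
    rw [this]; simp

/-- Superadditivity makes the lower exponential rate of a neighbourhood at least the upper
exponential rate of any smaller one. -/
lemma IsSuperadditive.eventually_le_of_frequently_le [∀ N, IsProbabilityMeasure (P N)]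
    (h : IsSuperadditive P Y m C) (hb : ∀ k x, ‖m k x‖ ≤ 1) (x : X) {r r' s : ℝ} (hr : 0 ≤ r)
    (hrr : r < r')
    (hs : ∃ᶠ N : ℕ in evenAtTop, ENNReal.ofReal (Real.exp (-(s * N))) ≤
      P N (Y N ⁻¹' momentNhd m x r)) :
    ∀ᶠ N : ℕ in evenAtTop, ENNReal.ofReal (Real.exp (-(s * N))) ≤
      P N (Y N ⁻¹' momentNhd m x r') := by
  have hδ : 0 < r' - r := sub_pos.2 hrr
  have hbig : ∀ c : ℝ, ∀ᶠ N : ℕ in evenAtTop, c ≤ (N : ℝ) * (r' - r) := fun c =>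
    eventually_evenAtTop_of_atTop
      ((tendsto_natCast_atTop_atTop.atTop_mul_const hδ).eventually_ge_atTop c)
  obtain ⟨n, hn, ⟨hnC, hn0⟩, hne⟩ :=
    (hs.and_eventually (((hbig (2 * C)).and eventually_pos).and eventually_even)).exists
  have hn0' : (0 : ℝ) < n := by exact_mod_cast hn0
  -- The size `n` is so large that the error `C` per copy costs at most half of `r' - r`; the
  -- remainder modulo `n` costs at most the other half once `N` is large.
  have hs0 : 0 ≤ s := by
    by_contra! hs0
    have h2 := hn.trans prob_le_one
    rw [← ENNReal.ofReal_one, ENNReal.ofReal_le_ofReal_iff zero_le_one, Real.exp_le_one_iff] at h2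
    nlinarith
  filter_upwards [eventually_even, hbig (4 * n), eventually_pos] with N hNe hN hN0
  have hdm : n * (N / n) + N % n = N := Nat.div_add_mod N n
  have hdm' : (n : ℝ) * (N / n : ℕ) + (N % n : ℕ) = N := by exact_mod_cast hdm
  have ht : Even (N % n) := by
    rw [Nat.even_iff, Nat.mod_mod_of_dvd N hne.two_dvd, ← Nat.even_iff]; exact hNe
  have htn : ((N % n : ℕ) : ℝ) ≤ n := by exact_mod_cast (Nat.mod_lt N hn0).le
  have hq : (0 : ℝ) ≤ (N / n : ℕ) := Nat.cast_nonneg _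
  have ht0 : (0 : ℝ) ≤ (N % n : ℕ) := Nat.cast_nonneg _
  rw [preimage_momentNhd hn0] at hn
  calc ENNReal.ofReal (Real.exp (-(s * N)))
      ≤ ENNReal.ofReal (Real.exp (-(s * n)) ^ (N / n)) := by
        rw [← Real.exp_nat_mul]
        refine ENNReal.ofReal_le_ofReal (Real.exp_le_exp.2 ?_)
        nlinarith [mul_nonneg hs0 ht0]
    _ = ENNReal.ofReal (Real.exp (-(s * n))) ^ (N / n) := ENNReal.ofReal_pow (Real.exp_pos _).le _
    _ ≤ P n (momentEvent Y m n (fun k => n * m k x) (n * r)) ^ (N / n) := by gcongr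
    _ ≤ P N (momentEvent Y m N (fun k => (N : ℕ) * m k x)
          ((N / n : ℕ) * (n * r + C) + 2 * (N % n : ℕ))) := by
        have := h.pow_le hb hne ht x (n * r) (N / n)
        rwa [hdm] at this
    _ ≤ P N (Y N ⁻¹' momentNhd m x r') := by
        rw [preimage_momentNhd hN0]
        refine measure_mono (momentEvent_subset (d := 0) (by simp) ?_)
        nlinarith [mul_nonneg hr ht0, mul_le_mul_of_nonneg_left hnC hq]

/-- The exponential decay rate of the probability that `Y N` is close to `x`. -/
noncomputable def decayRate (P : ∀ N, Measure (Ω N)) (Y : ∀ N, Ω N → X) (m : ℕ → X → ℂ) (x : X) :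
    EReal :=
  ⨆ (r : ℝ) (_ : 0 < r),
    -liminf (fun N : ℕ => ENNReal.log (P N (Y N ⁻¹' momentNhd m x r)) / (N : EReal)) evenAtTop

variable [TopologicalSpace X]

lemma isClosed_momentNhd (hm : ∀ k, Continuous (m k)) (x : X) (r : ℝ) :
    IsClosed (momentNhd m x r) := by
  simp only [momentNhd, Set.ofPred_forall]
  exact isClosed_iInter fun k =>
    isClosed_le (((hm k).sub continuous_const).norm) continuous_const

lemma momentNhd_mem_nhds (hm : ∀ k, Continuous (m k)) (hb : ∀ k x, ‖m k x‖ ≤ 1) (x : X) {r : ℝ}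
    (hr : 0 < r) : momentNhd m x r ∈ 𝓝 x := by
  obtain ⟨K, hK⟩ := exists_nat_ge (2 / r)
  have h1 : ∀ᶠ y in 𝓝 x, ∀ k ∈ Finset.range K, ‖m k y - m k x‖ < r := by
    refine (Finset.eventually_all _).2 fun k _ => ?_
    have := (((hm k).sub (continuous_const (y := m k x))).norm).continuousAt (x := x)
    exact this.eventually_lt continuousAt_const (by simpa using hr)
  filter_upwards [h1] with y hy k
  by_cases hk : k < K
  · refine (hy k (Finset.mem_range.2 hk)).le.trans ?_
    nlinarith [(Nat.cast_nonneg k : (0 : ℝ) ≤ k)]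
  · have hk' : (K : ℝ) ≤ k := by exact_mod_cast not_lt.1 hk
    have h2 : 2 ≤ r * (k + 1) := by
      have := (div_le_iff₀ hr).1 (hK.trans hk')
      nlinarith
    calc ‖m k y - m k x‖ ≤ ‖m k y‖ + ‖m k x‖ := norm_sub_le _ _
      _ ≤ r * (k + 1) := by linarith [hb k y, hb k x]

lemma exists_momentNhd_subset [CompactSpace X] (hm : ∀ k, Continuous (m k))
    (hinj : ∀ x y, (∀ k, m k x = m k y) → x = y) (x : X) {U : Set X} (hU : U ∈ 𝓝 x) :
    ∃ r : ℝ, 0 < r ∧ momentNhd m x r ⊆ U := by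
  obtain ⟨O, hOU, hO, hxO⟩ := mem_nhds_iff.1 hU
  -- By compactness: the closed sets `momentNhd m x r` decrease to `{x}` as `r` tends to zero.
  have hdir : Directed (· ⊇ ·) fun n : ℕ => momentNhd m x (1 / ((n : ℝ) + 1)) := by
    refine directed_of_isDirected_le fun n n' h => momentNhd_mono x ?_
    exact one_div_le_one_div_of_le (by positivity) (by gcongr)
  have hempty : Oᶜ ∩ ⋂ n : ℕ, momentNhd m x (1 / ((n : ℝ) + 1)) = ∅ := by
    refine Set.eq_empty_of_forall_notMem fun y hy => hy.1 ?_
    have hyx : y = x := by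
      refine hinj y x fun k => ?_
      rw [← sub_eq_zero, ← norm_le_zero_iff]
      have ht : Tendsto (fun n : ℕ => 1 / ((n : ℝ) + 1) * (k + 1)) atTop (𝓝 (0 * ((k : ℝ) + 1))) :=
        tendsto_one_div_add_atTop_nhds_zero_nat.mul_const _
      rw [zero_mul] at ht
      exact ge_of_tendsto' ht fun n => Set.mem_iInter.1 hy.2 n k
    exact hyx ▸ hxO
  obtain ⟨n, hn⟩ := hO.isClosed_compl.isCompact.elim_directed_family_closed _
    (fun n => isClosed_momentNhd hm x _) hempty hdir
  refine ⟨1 / ((n : ℝ) + 1), by positivity, fun y hy => hOU ?_⟩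
  by_contra hyO
  exact Set.eq_empty_iff_forall_notMem.1 hn y ⟨hyO, hy⟩

theorem IsSuperadditive.isLocalRate_decayRate [CompactSpace X] [∀ N, IsProbabilityMeasure (P N)]
    (h : IsSuperadditive P Y m C) (hm : ∀ k, Continuous (m k)) (hb : ∀ k x, ‖m k x‖ ≤ 1)
    (hinj : ∀ x y, (∀ k, m k x = m k y) → x = y) : IsLocalRate P Y (decayRate P Y m) where
  lower x s hs U hU := by
    obtain ⟨r, hr, hrU⟩ := exists_momentNhd_subset hm hinj x hU
    have h1 : -liminf (fun N : ℕ => ENNReal.log (P N (Y N ⁻¹' momentNhd m x r)) / (N : EReal))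
        evenAtTop < s := lt_of_le_of_lt (le_iSup₂_of_le r hr le_rfl) hs
    filter_upwards [eventually_lt_of_lt_liminf (EReal.neg_lt_comm.1 h1), eventually_pos]
      with N hN h0
    exact ((neg_le_log_div_iff h0).1 hN.le).trans (measure_mono (Set.preimage_mono hrU))
  upper x s hs := by
    obtain ⟨r, hs⟩ := lt_iSup_iff.1 hs
    obtain ⟨hr, hs⟩ := lt_iSup_iff.1 hs
    refine ⟨momentNhd m x (r / 2), momentNhd_mem_nhds hm hb x (half_pos hr), ?_⟩
    by_contra hcon
    have hfreq : ∃ᶠ N : ℕ in evenAtTop, ENNReal.ofReal (Real.exp (-(s * N))) ≤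
        P N (Y N ⁻¹' momentNhd m x (r / 2)) :=
      (not_eventually.1 hcon).mono fun N hN => (not_le.1 hN).le
    have hev := h.eventually_le_of_frequently_le hb x (half_pos hr).le (half_lt_self hr) hfreq
    refine (EReal.lt_neg_comm.1 hs).not_ge (le_liminf_of_le (by isBoundedDefault) ?_)
    filter_upwards [hev, eventually_pos] with N hN h0
    exact (neg_le_log_div_iff h0).2 hN

/-- A system of size `N` is made of one of size about `a N` and one of size about `b N`; letting
their moments be close to those of `x` and `y` makes the moments of the whole close to those of the
barycentre `z`. -/
theorem IsSuperadditive.convex [∀ N, IsProbabilityMeasure (P N)] {I : X → EReal}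
    (h : IsSuperadditive P Y m C) (hI : IsLocalRate P Y I) (hm : ∀ k, Continuous (m k))
    (hb : ∀ k x, ‖m k x‖ ≤ 1) (hinj : ∀ x y, (∀ k, m k x = m k y) → x = y) [CompactSpace X]
    {x y z : X} {a b : ℝ} (ha : 0 ≤ a) (hb0 : 0 ≤ b) (hab : a + b = 1)
    (hz : ∀ k, m k z = a * m k x + b * m k y) :
    I z ≤ (a : EReal) * I x + (b : EReal) * I y := by
  rcases ha.eq_or_lt with rfl | ha
  · obtain rfl : b = 1 := by linarith
    have : z = y := hinj _ _ fun k => by simp [hz k]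
    simp [this]
  rcases hb0.eq_or_lt with rfl | hb1
  · obtain rfl : a = 1 := by linarith
    have : z = x := hinj _ _ fun k => by simp [hz k]
    simp [this]
  have hx0 := hI.nonneg x
  have hy0 := hI.nonneg y
  have hmul : ∀ {c : ℝ} {w : EReal}, 0 < c → 0 ≤ w → (c : EReal) * w ≠ ⊥ := fun hc hw =>
    ne_bot_of_le_ne_bot (by simp) (mul_nonneg (EReal.coe_nonneg.2 hc.le) hw)
  by_cases hxt : I x = ⊤
  · rw [hxt, EReal.coe_mul_top_of_pos ha, EReal.top_add_of_ne_bot (hmul hb1 hy0)]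
    exact le_top
  by_cases hyt : I y = ⊤
  · rw [hyt, EReal.coe_mul_top_of_pos hb1, EReal.add_top_of_ne_bot (hmul ha hx0)]
    exact le_top
  lift I x to ℝ using ⟨hxt, ne_bot_of_le_ne_bot (by simp) hx0⟩ with p hp
  lift I y to ℝ using ⟨hyt, ne_bot_of_le_ne_bot (by simp) hy0⟩ with q hq
  have hp0 : 0 ≤ p := EReal.coe_nonneg.1 hx0
  have hq0 : 0 ≤ q := EReal.coe_nonneg.1 hy0
  by_contra! hlt
  have hlt' : ((a * p + b * q : ℝ) : EReal) < I z := by exact_mod_cast hlt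
  obtain ⟨s, hs, hsz⟩ := EReal.lt_iff_exists_real_btwn.1 hlt'
  have hs : a * p + b * q < s := EReal.coe_lt_coe_iff.1 hs
  -- The margin is shared between the rates at `x` and `y` and the rounding of `b N`.
  obtain ⟨ε, hε, hεs⟩ : ∃ ε : ℝ, 0 < ε ∧ a * (p + ε) + b * (q + ε) + ε = s := by
    refine ⟨(s - (a * p + b * q)) / 2, by linarith, ?_⟩
    linear_combination (s - (a * p + b * q)) / 2 * hab
  obtain ⟨U, hU, hUN⟩ := hI.upper z s hsz
  obtain ⟨r, hr, hrU⟩ := exists_momentNhd_subset hm hinj z hU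
  have hlow : ∀ w : X, ∀ c : ℝ, I w = c → ∀ᶠ N : ℕ in evenAtTop,
      ENNReal.ofReal (Real.exp (-((c + ε) * N))) ≤
        P N (momentEvent Y m N (fun k => N * m k w) (N * (r / 2))) := fun w c hc => by
    filter_upwards [hI.lower w (c + ε) (by rw [hc]; exact EReal.coe_lt_coe_iff.2 (by linarith))
      _ (momentNhd_mem_nhds hm hb w (half_pos hr)), eventually_pos] with N hN h0
    rwa [preimage_momentNhd h0] at hN
  -- `n N` is the largest even integer that is at most `a N`.
  set n : ℕ → ℕ := fun N => 2 * ⌊a * (N : ℝ) / 2⌋₊ with hn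
  have hn1 : ∀ N : ℕ, (n N : ℝ) ≤ a * N := fun N => by
    have := Nat.floor_le (show 0 ≤ a * N / 2 by positivity)
    simp only [hn]; push_cast; linarith
  have hn2 : ∀ N : ℕ, a * N - 2 ≤ (n N : ℝ) := fun N => by
    have := (Nat.lt_floor_add_one (a * N / 2)).le
    simp only [hn]; push_cast; linarith
  have hnN : ∀ N : ℕ, n N ≤ N := fun N => by
    have : (n N : ℝ) ≤ N := (hn1 N).trans (by nlinarith [(Nat.cast_nonneg N : (0 : ℝ) ≤ N)])
    exact_mod_cast this
  have hl1 : ∀ N : ℕ, ((N - n N : ℕ) : ℝ) = N - n N := fun N => Nat.cast_sub (hnN N)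
  have hbN : ∀ N : ℕ, b * N = N - a * N := fun N => by linear_combination (N : ℝ) * hab
  have htn : Tendsto n evenAtTop evenAtTop := by
    refine tendsto_inf.2 ⟨?_, tendsto_principal.2 (Eventually.of_forall fun N => even_two_mul _)⟩
    refine Tendsto.mono_left ?_ inf_le_left
    refine tendsto_natCast_atTop_iff.1 (tendsto_atTop_mono hn2 ?_)
    exact tendsto_atTop_add_const_right _ _
      (tendsto_natCast_atTop_atTop.const_mul_atTop ha)
  have htl : Tendsto (fun N => N - n N) evenAtTop evenAtTop := by
    refine tendsto_inf.2 ⟨?_, tendsto_principal.2 ?_⟩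
    · refine Tendsto.mono_left ?_ inf_le_left
      refine tendsto_natCast_atTop_iff.1 (tendsto_atTop_mono (f := fun N : ℕ => b * N)
        (fun N => ?_) (tendsto_natCast_atTop_atTop.const_mul_atTop hb1))
      rw [hl1, hbN]; linarith [hn1 N]
    · filter_upwards [eventually_even] with N hN
      exact (Nat.even_sub (hnN N)).2 (by simp [hN, hn])
  have hbig : ∀ c δ : ℝ, 0 < δ → ∀ᶠ N : ℕ in evenAtTop, c < (N : ℝ) * δ := fun c δ hδ =>
    eventually_evenAtTop_of_atTop
      ((tendsto_natCast_atTop_atTop.atTop_mul_const hδ).eventually_gt_atTop c)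
  obtain ⟨N, ⟨⟨⟨h1, h2⟩, h3⟩, h4⟩, ⟨h5, h6⟩, h7⟩ :=
    (((((htn.eventually (hlow x p hp.symm)).and (htl.eventually (hlow y q hq.symm))).and hUN).and
      (eventually_even.and eventually_pos)).and
      (((hbig (C + 4) (r / 2) (half_pos hr)).and (hbig (2 * (q + ε)) ε hε)).and
        (htn.eventually eventually_even |>.and (htl.eventually eventually_even)))).exists
  have hsum : n N + (N - n N) = N := Nat.add_sub_cancel' (hnN N)
  have hsup := h (n N) (N - n N) h7.1 h7.2 (fun k => n N * m k x) (fun k => (N - n N : ℕ) * m k y)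
    (n N * (r / 2)) ((N - n N : ℕ) * (r / 2))
  rw [hsum] at hsup
  have hsub : momentEvent Y m N (fun k => n N * m k x + (N - n N : ℕ) * m k y)
      (n N * (r / 2) + (N - n N : ℕ) * (r / 2) + C) ⊆ Y N ⁻¹' U := by
    refine Set.Subset.trans ?_ (Set.preimage_mono hrU)
    rw [preimage_momentNhd h4.2]
    refine momentEvent_subset (d := 4) (fun k => ?_) ?_
    · have e : (n N : ℂ) * m k x + (N - n N : ℕ) * m k y - N * m k z =
          ((n N - a * N : ℝ) : ℂ) * m k x + ((a * N - n N : ℝ) : ℂ) * m k y := by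
        rw [hz k, Nat.cast_sub (hnN N)]
        have : (b : ℂ) = 1 - a := by rw [← Complex.ofReal_one, ← hab]; push_cast; ring
        push_cast
        rw [this]; ring
      rw [e]
      have habs : |(n N : ℝ) - a * N| ≤ 2 := abs_le.2 ⟨by linarith [hn2 N], by linarith [hn1 N]⟩
      have habs' : |a * N - (n N : ℝ)| ≤ 2 := by rwa [abs_sub_comm]
      calc _ ≤ ‖((n N - a * N : ℝ) : ℂ) * m k x‖ + ‖((a * N - n N : ℝ) : ℂ) * m k y‖ :=
            norm_add_le _ _
        _ ≤ 2 * 1 + 2 * 1 := by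
            rw [norm_mul, norm_mul, Complex.norm_real, Complex.norm_real, Real.norm_eq_abs,
              Real.norm_eq_abs]
            gcongr
            · exact hb k x
            · exact hb k y
        _ ≤ 4 * ((k : ℝ) + 1) := by linarith [(Nat.cast_nonneg k : (0 : ℝ) ≤ k)]
    · rw [hl1]; linarith
  have hfin : ENNReal.ofReal (Real.exp (-((p + ε) * n N))) *
      ENNReal.ofReal (Real.exp (-((q + ε) * (N - n N : ℕ)))) ≤
        ENNReal.ofReal (Real.exp (-(s * N))) :=
    (mul_le_mul' h1 h2).trans (hsup.trans ((measure_mono hsub).trans h3))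
  rw [← ENNReal.ofReal_mul (Real.exp_pos _).le, ← Real.exp_add,
    ENNReal.ofReal_le_ofReal_iff (Real.exp_pos _).le, Real.exp_le_exp, hl1] at hfin
  have e1 : (p + ε) * n N ≤ (p + ε) * (a * N) :=
    mul_le_mul_of_nonneg_left (hn1 N) (by linarith)
  have e2 : (q + ε) * (N - n N) ≤ (q + ε) * (b * N + 2) :=
    mul_le_mul_of_nonneg_left (by rw [hbN]; linarith [hn2 N]) (by linarith)
  have e3 : s * N = (p + ε) * (a * N) + (q + ε) * (b * N) + N * ε := by rw [← hεs]; ring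
  linarith

end Superadditive

/-! ### Traces of powers and moments of the empirical measure -/

open Polynomial in
/-- Factor `p` over its roots, and evaluate each determinant `det (A - r)` by the characteristic
polynomial of `A`. -/
lemma det_aeval_eq_prod_roots {n K : Type*} [Fintype n] [DecidableEq n] [Field K] [IsAlgClosed K]
    (A : Matrix n n K) (p : K[X]) :
    (aeval A p).det = (A.charpoly.roots.map fun z => p.eval z).prod := by
  have hcard : A.charpoly.roots.card = Fintype.card n := by
    rw [IsAlgClosed.card_roots_eq_natDegree, A.charpoly_natDegree_eq_dim]
  have hA : ∀ r : K, (A - algebraMap K _ r).det = (A.charpoly.roots.map fun z => z - r).prod := by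
    intro r
    have h1 : A.charpoly.eval r = (A.charpoly.roots.map fun z => r - z).prod := by
      have h2 := (IsAlgClosed.splits A.charpoly).eq_prod_roots
      rw [A.charpoly_monic.leadingCoeff, map_one, one_mul] at h2
      conv_lhs => rw [h2]
      simp [eval_multiset_prod, Multiset.map_map]
    have h3 : (A - algebraMap K _ r) = -(Matrix.scalar n r - A) := by
      rw [neg_sub]; rfl
    have h4 : Fintype.card n = (A.charpoly.roots.map fun z => r - z).card := by
      rw [Multiset.card_map, hcard]
    rw [h3, Matrix.det_neg, ← Matrix.eval_charpoly, h1, h4, ← Multiset.prod_map_neg,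
      Multiset.map_map]
    simp
  let Φ : K[X] →* K := Matrix.detMonoidHom.comp (aeval A : K[X] →ₐ[K] Matrix n n K).toMonoidHom
  have hΦX : ∀ r : K, Φ (X - C r) = (A - algebraMap K _ r).det := fun r => by
    simp [Φ]
  have hΦC : ∀ c : K, Φ (C c) = (A.charpoly.roots.map fun _ => c).prod := fun c => by
    simp [Φ, hcard, Matrix.algebraMap_eq_diagonal]
  have hp := (IsAlgClosed.splits p).eq_prod_roots
  calc (aeval A p).det = Φ p := rfl
    _ = Φ (C p.leadingCoeff) * (p.roots.map fun r => Φ (X - C r)).prod := by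
        conv_lhs => rw [hp]
        rw [map_mul, map_multiset_prod, Multiset.map_map]
        rfl
    _ = (A.charpoly.roots.map fun z => p.leadingCoeff * (p.roots.map fun r => z - r).prod).prod := by
        simp only [hΦX, hA, hΦC]
        rw [Multiset.prod_map_prod_map, ← Multiset.prod_map_mul]
    _ = (A.charpoly.roots.map fun z => p.eval z).prod := by
        refine congrArg _ (Multiset.map_congr rfl fun z _ => ?_)
        conv_rhs => rw [hp]
        simp [eval_multiset_prod, Multiset.map_map]

/-- The characteristic polynomial of `A ^ k` takes the value `det (w - A ^ k)` at `w`, which is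
`∏ (w - z ^ k)` over the eigenvalues `z` of `A`. -/
lemma trace_pow_eq_sum_roots {n K : Type*} [Fintype n] [DecidableEq n] [Field K] [IsAlgClosed K]
    (A : Matrix n n K) (k : ℕ) :
    (A ^ k).trace = (A.charpoly.roots.map fun z => z ^ k).sum := by
  have h : (A ^ k).charpoly =
      (A.charpoly.roots.map fun z => Polynomial.X - Polynomial.C (z ^ k)).prod := by
    refine Polynomial.funext fun w => ?_
    have h1 : Matrix.scalar n w - A ^ k =
        Polynomial.aeval A (Polynomial.C w - Polynomial.X ^ k) := by
      simp only [map_sub, Polynomial.aeval_C, map_pow, Polynomial.aeval_X]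
      rfl
    rw [Matrix.eval_charpoly, h1, det_aeval_eq_prod_roots, Polynomial.eval_multiset_prod,
      Multiset.map_map]
    simp
  have h2 := Polynomial.roots_multiset_prod_X_sub_C (A.charpoly.roots.map fun z => z ^ k)
  rw [Multiset.map_map] at h2
  rw [Matrix.trace_eq_sum_roots_charpoly, h]
  exact congrArg Multiset.sum h2

open scoped Matrix.Norms.L2Operator in
lemma norm_eq_one_of_mem_roots {n : Type*} [Fintype n] [DecidableEq n] {A : Matrix n n ℂ}
    (hA : A ∈ Matrix.unitaryGroup n ℂ) {z : ℂ} (hz : z ∈ A.charpoly.roots) : ‖z‖ = 1 := by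
  have h := spectrum.subset_circle_of_unitary hA
    (Matrix.mem_spectrum_of_isRoot_charpoly (Polynomial.isRoot_of_mem_roots hz))
  simpa using h

/-- The moments `∫ z ^ k dμ` of a probability measure on the circle. -/
noncomputable def circleMoment (k : ℕ) (μ : ProbabilityMeasure Circle) : ℂ :=
  ∫ z, (z : ℂ) ^ k ∂(μ : Measure Circle)

lemma integral_sum_dirac {E : Type*} [NormedAddCommGroup E] [NormedSpace ℝ E] [CompleteSpace E]
    (f : Circle → E) (s : Multiset Circle) :
    Integrable f (s.map fun z => Measure.dirac z).sum ∧
      ∫ z, f z ∂(s.map fun z => Measure.dirac z).sum = (s.map f).sum := by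
  induction s using Multiset.induction_on with
  | empty => simp
  | cons a s ih =>
    have ha : Integrable f (Measure.dirac a) := integrable_dirac (by simp)
    rw [Multiset.map_cons, Multiset.sum_cons, Multiset.map_cons, Multiset.sum_cons]
    exact ⟨ha.add_measure ih.1, by rw [integral_add_measure ha ih.1, ih.2, integral_dirac]⟩

lemma integral_empiricalMeasure {E : Type*} [NormedAddCommGroup E] [NormedSpace ℝ E]
    [CompleteSpace E] {N : ℕ} (A : Matrix (Fin N) (Fin N) ℂ) (f : Circle → E) :
    (N : ℝ) • ∫ z, f z ∂(empiricalMeasure A : Measure Circle) =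
      ((circleEigenvalues A).map f).sum := by
  by_cases hN : N = 0
  · subst hN
    have : circleEigenvalues A = 0 := Multiset.card_eq_zero.1 (card_circleEigenvalues A)
    simp [this]
  · have hN' : (N : ℝ) ≠ 0 := by exact_mod_cast hN
    have h : (empiricalMeasure A : Measure Circle) = eigenvalueMeasure A :=
      congrArg ProbabilityMeasure.toMeasure (dif_pos hN)
    rw [h, eigenvalueMeasure, integral_smul_measure, (integral_sum_dirac f _).2, smul_smul]
    simp [hN']

/-- For a unitary matrix the phases of the eigenvalues are the eigenvalues themselves. -/
lemma natCast_mul_circleMoment {N : ℕ} {A : Matrix (Fin N) (Fin N) ℂ}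
    (hA : A ∈ Matrix.unitaryGroup (Fin N) ℂ) (k : ℕ) :
    (N : ℂ) * circleMoment k (empiricalMeasure A) = (A ^ k).trace := by
  have h := integral_empiricalMeasure A fun z : Circle => (z : ℂ) ^ k
  rw [Complex.real_smul, Complex.ofReal_natCast] at h
  rw [circleMoment, h, trace_pow_eq_sum_roots, circleEigenvalues, Multiset.map_map]
  refine congrArg _ (Multiset.map_congr rfl fun z hz => ?_)
  have h1 := norm_eq_one_of_mem_roots hA hz
  have h2 := Complex.norm_mul_exp_arg_mul_I z
  rw [h1, Complex.ofReal_one, one_mul] at h2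
  simp [Circle.coe_exp, h2]

lemma traceFun_eq {N : ℕ} (V : Circle → ℝ) (A : Matrix (Fin N) (Fin N) ℂ) :
    traceFun V A = N * ∫ z, V z ∂(empiricalMeasure A : Measure Circle) :=
  (integral_empiricalMeasure A V).symm

lemma continuous_circleMoment (k : ℕ) : Continuous (circleMoment k) := by
  refine continuous_iff_continuousAt.2 fun μ => ?_
  have h := (ProbabilityMeasure.tendsto_iff_forall_integral_rclike_tendsto ℂ).1
    (tendsto_id (x := 𝓝 μ)) (BoundedContinuousFunction.mkOfCompact
      ⟨fun z : Circle => (z : ℂ) ^ k, by fun_prop⟩)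
  exact h

lemma norm_circleMoment_le (k : ℕ) (μ : ProbabilityMeasure Circle) : ‖circleMoment k μ‖ ≤ 1 := by
  have h := norm_integral_le_of_norm_le_const (μ := (μ : Measure Circle)) (C := 1)
    (f := fun z : Circle => (z : ℂ) ^ k) (ae_of_all _ fun z => by simp [Circle.norm_coe])
  simpa [circleMoment] using h

/-- Trigonometric polynomials are dense, and the moments of negative order are the conjugates of
those of positive order. -/
lemma eq_of_circleMoment_eq (μ ν : ProbabilityMeasure Circle)
    (h : ∀ k, circleMoment k μ = circleMoment k ν) : μ = ν := by
  have : Fact ((0 : ℝ) < 2 * Real.pi) := ⟨Real.two_pi_pos⟩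
  let e := AddCircle.homeomorphCircle (T := 2 * Real.pi) Real.two_pi_pos.ne'
  let Λ : ProbabilityMeasure Circle → C(AddCircle (2 * Real.pi), ℂ) →L[ℂ] ℂ := fun μ =>
    LinearMap.mkContinuous
      { toFun := fun g => ∫ z, g (e.symm z) ∂(μ : Measure Circle)
        map_add' := fun f g => integral_add
          ((f.continuous.comp e.symm.continuous).integrable_of_hasCompactSupport
            (HasCompactSupport.of_compactSpace _))
          ((g.continuous.comp e.symm.continuous).integrable_of_hasCompactSupport
            (HasCompactSupport.of_compactSpace _))
        map_smul' := fun c g => integral_const_mul c _ } 1 fun g => by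
      have := norm_integral_le_of_norm_le_const (μ := (μ : Measure Circle)) (C := ‖g‖)
        (f := fun z => g (e.symm z)) (ae_of_all _ fun z => g.norm_coe_le_norm _)
      simpa using this
  have hpow : ∀ (μ : ProbabilityMeasure Circle) (n : ℤ),
      Λ μ (fourier n) = ∫ z, ((z ^ n : Circle) : ℂ) ∂(μ : Measure Circle) := fun μ n => by
    change ∫ z, fourier n (e.symm z) ∂(μ : Measure Circle) = _
    refine integral_congr_ae (ae_of_all _ fun z => ?_)
    have h1 : AddCircle.toCircle (e.symm z) = z := by
      rw [← AddCircle.homeomorphCircle_apply Real.two_pi_pos.ne']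
      exact e.apply_symm_apply z
    simp only [fourier_apply]
    rw [AddCircle.toCircle_zsmul, h1]
  have hnat : ∀ (μ : ProbabilityMeasure Circle) (k : ℕ), Λ μ (fourier k) = circleMoment k μ :=
    fun μ k => by rw [hpow]; simp [circleMoment]
  have hneg : ∀ (μ : ProbabilityMeasure Circle) (k : ℕ),
      Λ μ (fourier (-(k : ℤ))) = conj (circleMoment k μ) := fun μ k => by
    rw [hpow, circleMoment, ← integral_conj]
    refine integral_congr_ae (ae_of_all _ fun z => ?_)
    simp only [zpow_neg, zpow_natCast, Circle.coe_inv_eq_conj, Circle.coe_pow]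
  have hfour : ∀ n : ℤ, Λ μ (fourier n) = Λ ν (fourier n) := fun n => by
    obtain ⟨k, rfl | rfl⟩ := n.eq_nat_or_neg
    · rw [hnat, hnat, h]
    · rw [hneg, hneg, h]
  have hΛ : Λ μ = Λ ν := by
    refine ContinuousLinearMap.ext_on (s := Set.range (fourier (T := 2 * Real.pi))) ?_ ?_
    · rw [Submodule.dense_iff_topologicalClosure_eq_top]
      exact span_fourier_closure_eq_top
    · rintro _ ⟨n, rfl⟩
      exact hfour n
  refine ProbabilityMeasure.toMeasure_injective
    (ext_of_forall_integral_eq_of_IsFiniteMeasure fun f => ?_)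
  have h1 := congrArg (fun Λ : C(AddCircle (2 * Real.pi), ℂ) →L[ℂ] ℂ =>
    Λ ⟨fun x => (f (e x) : ℂ), by fun_prop⟩) hΛ
  change ∫ z, ((f (e (e.symm z)) : ℝ) : ℂ) ∂(μ : Measure Circle) =
    ∫ z, ((f (e (e.symm z)) : ℝ) : ℂ) ∂(ν : Measure Circle) at h1
  simp only [e.apply_symm_apply] at h1
  rw [integral_complex_ofReal, integral_complex_ofReal] at h1
  exact_mod_cast h1

/-! ### Unitarity and locality of the Lax matrix -/

section Block

variable {n : Type*} [DecidableEq n]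

/-- The matrix `Ξ(z)` on the rows and columns `i` and `j` of a matrix with arbitrary index type. -/
noncomputable def block (i j : n) (z : ℂ) : Matrix n n ℂ :=
  Matrix.single i i (conj z) + Matrix.single i j (rho z : ℂ) + Matrix.single j i (rho z : ℂ) +
    Matrix.single j j (-z)

lemma rho_le_one (z : ℂ) : rho z ≤ 1 :=
  Real.sqrt_le_one.2 (by nlinarith [sq_nonneg ‖z‖])

variable [Fintype n]

lemma conjTranspose_block_mul_of_ne {i j k l : n} (z w : ℂ) (h1 : i ≠ k) (h2 : i ≠ l) (h3 : j ≠ k)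
    (h4 : j ≠ l) : (block i j z).conjTranspose * block k l w = 0 := by
  simp [block, Matrix.conjTranspose_add, Matrix.conjTranspose_single, mul_add, add_mul,
    Matrix.single_mul_single_of_ne, h1, h2, h3, h4]

lemma conjTranspose_block_mul_self {i j : n} {z : ℂ} (hij : i ≠ j) (hz : ‖z‖ ≤ 1) :
    (block i j z).conjTranspose * block i j z = Matrix.single i i 1 + Matrix.single j j 1 := by
  have h : z * conj z + (rho z : ℂ) * rho z = 1 := by
    rw [Complex.mul_conj, Complex.normSq_eq_norm_sq, ← Complex.ofReal_mul, rho,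
      Real.mul_self_sqrt (by nlinarith [norm_nonneg z])]
    push_cast; ring
  have h' : (rho z : ℂ) * rho z + conj z * z = 1 := by rw [← h]; ring
  have e : (block i j z).conjTranspose * block i j z =
      Matrix.single i i (z * conj z + (rho z : ℂ) * rho z) +
        Matrix.single i j (z * rho z + rho z * -z) +
        Matrix.single j i (rho z * conj z + -conj z * rho z) +
        Matrix.single j j ((rho z : ℂ) * rho z + -conj z * -z) := by
    simp only [block, Matrix.conjTranspose_add, Matrix.conjTranspose_single, mul_add, add_mul,
      Matrix.single_mul_single_of_ne, hij, hij.symm, ne_eq, not_false_eq_true, Matrix.single_add,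
      Matrix.single_mul_single_same, star_neg, RCLike.star_def, Complex.conj_ofReal,
      Complex.conj_conj, add_zero, zero_add]
    abel
  rw [e, h, neg_mul_neg, h', show z * (rho z : ℂ) + rho z * -z = 0 by ring,
    show (rho z : ℂ) * conj z + -conj z * rho z = 0 by ring]
  simp

lemma norm_trace_block_mul_le {i j : n} {z : ℂ} (hz : ‖z‖ ≤ 1) {A : Matrix n n ℂ}
    (hA : ∀ k l, ‖A k l‖ ≤ 1) : ‖(block i j z * A).trace‖ ≤ 4 := by
  have hr : |rho z| ≤ 1 := by
    rw [abs_of_nonneg (show 0 ≤ rho z from Real.sqrt_nonneg _)]; exact rho_le_one z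
  have key : ∀ (c : ℂ) (k l : n), ‖c‖ ≤ 1 → ‖c * A k l‖ ≤ 1 := fun c k l hc => by
    rw [norm_mul]; exact mul_le_one₀ hc (norm_nonneg _) (hA k l)
  simp only [block, add_mul, Matrix.trace_add, Matrix.trace_single_mul, smul_eq_mul]
  have h1 := key (conj z) i i (by simpa using hz)
  have h2 := key (rho z) j i (by simpa using hr)
  have h3 := key (rho z) i j (by simpa using hr)
  have h4 := key (-z) j j (by simpa using hz)
  refine (norm_add_le _ _).trans ?_
  refine (add_le_add_left (norm_add_le _ _) _).trans ?_
  refine (add_le_add_left (add_le_add_left (norm_add_le _ _) _) _).trans ?_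
  linarith

/-- The blocks `Ξ(α j)` on the rows and columns `j` and `σ j`, for `j ∈ S`, partition the index set
if `σ` exchanges `S` and its complement; they then make up a unitary matrix. -/
lemma sum_block_mem_unitaryGroup (σ : Equiv.Perm n) (S : Finset n)
    (hσ : ∀ j, σ j ∈ S ↔ j ∉ S) {α : n → ℂ} (hα : ∀ j, ‖α j‖ ≤ 1) :
    ∑ j ∈ S, block j (σ j) (α j) ∈ Matrix.unitaryGroup n ℂ := by
  rw [Matrix.mem_unitaryGroup_iff', Matrix.star_eq_conjTranspose, Matrix.conjTranspose_sum,
    Finset.sum_mul_sum]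
  have hne : ∀ i ∈ S, ∀ j ∈ S, i ≠ σ j := fun i hi j hj h => (hσ j).1 (h ▸ hi) hj
  have h1 : ∀ i ∈ S, ∑ j ∈ S, (block i (σ i) (α i)).conjTranspose * block j (σ j) (α j) =
      Matrix.single i i 1 + Matrix.single (σ i) (σ i) 1 := fun i hi => by
    rw [Finset.sum_eq_single_of_mem i hi, conjTranspose_block_mul_self (hne i hi i hi) (hα i)]
    intro j hj hji
    exact conjTranspose_block_mul_of_ne _ _ hji.symm (hne i hi j hj) (hne j hj i hi).symm
      fun h => hji (σ.injective h).symm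
  rw [Finset.sum_congr rfl h1, Finset.sum_add_distrib]
  have h2 : ∑ i ∈ S, Matrix.single (σ i) (σ i) (1 : ℂ) = ∑ i ∈ Sᶜ, Matrix.single i i (1 : ℂ) := by
    refine Finset.sum_bij (fun i _ => σ i) (fun i hi => ?_) (fun i _ j _ h => σ.injective h)
      (fun i hi => ⟨σ.symm i, ?_, σ.apply_symm_apply i⟩) fun i _ => rfl
    · rw [Finset.mem_compl, hσ]; simpa using hi
    · have := hσ (σ.symm i)
      rw [σ.apply_symm_apply] at this
      rw [Finset.mem_compl] at hi
      exact not_not.1 fun h => hi (this.2 h)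
  rw [h2, Finset.sum_add_sum_compl, Matrix.sum_single_one]

end Block

lemma xiBlock_eq_block {N : ℕ} (α : Fin N → ℂ) (j : Fin N) :
    xiBlock α j = block j (finRotate N j) (α j) := rfl

lemma val_finRotate {N : ℕ} (j : Fin N) :
    (finRotate N j).val = if j.val + 1 = N then 0 else j.val + 1 := by
  cases N with
  | zero => exact j.elim0
  | succ N => rw [coe_finRotate]; simp [Fin.ext_iff]

lemma even_val_finRotate {N : ℕ} (hN : Even N) (j : Fin N) :
    Even (finRotate N j).val ↔ ¬ Even j.val := by
  rw [val_finRotate]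
  split_ifs with h
  · rw [← h, Nat.even_add_one] at hN; simpa using hN
  · rw [Nat.even_add_one]

lemma matL_mem_unitaryGroup {N : ℕ} (hN : Even N) {α : Fin N → ℂ} (hα : ∀ j, ‖α j‖ ≤ 1) :
    matL α ∈ Matrix.unitaryGroup (Fin N) ℂ :=
  sum_block_mem_unitaryGroup (finRotate N) _ 
    (fun j => by rw [Finset.mem_filter_univ, Finset.mem_filter_univ, even_val_finRotate hN]) hα

lemma matM_mem_unitaryGroup {N : ℕ} (hN : Even N) {α : Fin N → ℂ} (hα : ∀ j, ‖α j‖ ≤ 1) :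
    matM α ∈ Matrix.unitaryGroup (Fin N) ℂ :=
  sum_block_mem_unitaryGroup (finRotate N) _
    (fun j => by
      rw [Finset.mem_filter_univ, Finset.mem_filter_univ, ← Nat.not_even_iff_odd,
        ← Nat.not_even_iff_odd, even_val_finRotate hN]) hα

lemma laxMatrix_mem_unitaryGroup {N : ℕ} (hN : Even N) {α : Fin N → ℂ} (hα : ∀ j, ‖α j‖ ≤ 1) :
    laxMatrix α ∈ Matrix.unitaryGroup (Fin N) ℂ :=
  mul_mem (matL_mem_unitaryGroup hN hα) (matM_mem_unitaryGroup hN hα)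

section DirectSum

variable {N M : ℕ}

/-- The block diagonal matrix `A ⊕ B`, with rows and columns indexed by `Fin (N + M)`. -/
def directSum (A : Matrix (Fin N) (Fin N) ℂ) (B : Matrix (Fin M) (Fin M) ℂ) :
    Matrix (Fin (N + M)) (Fin (N + M)) ℂ :=
  Matrix.reindex finSumFinEquiv finSumFinEquiv (Matrix.fromBlocks A 0 0 B)

lemma directSum_mul (A A' : Matrix (Fin N) (Fin N) ℂ) (B B' : Matrix (Fin M) (Fin M) ℂ) :
    directSum A B * directSum A' B' = directSum (A * A') (B * B') := by
  simp [directSum, Matrix.submatrix_mul_equiv, Matrix.fromBlocks_multiply]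

lemma directSum_one : directSum (1 : Matrix (Fin N) (Fin N) ℂ) (1 : Matrix (Fin M) (Fin M) ℂ) =
    1 := by
  simp [directSum]

lemma directSum_pow (A : Matrix (Fin N) (Fin N) ℂ) (B : Matrix (Fin M) (Fin M) ℂ) (k : ℕ) :
    directSum A B ^ k = directSum (A ^ k) (B ^ k) := by
  induction k with
  | zero => simp [directSum_one]
  | succ k ih => rw [pow_succ, ih, directSum_mul, pow_succ, pow_succ]

lemma trace_directSum (A : Matrix (Fin N) (Fin N) ℂ) (B : Matrix (Fin M) (Fin M) ℂ) :
    (directSum A B).trace = A.trace + B.trace := by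
  simp [directSum, Matrix.trace, Fin.sum_univ_add]

lemma directSum_mem_unitaryGroup {A : Matrix (Fin N) (Fin N) ℂ} {B : Matrix (Fin M) (Fin M) ℂ}
    (hA : A ∈ Matrix.unitaryGroup (Fin N) ℂ) (hB : B ∈ Matrix.unitaryGroup (Fin M) ℂ) :
    directSum A B ∈ Matrix.unitaryGroup (Fin (N + M)) ℂ := by
  have h : star (directSum A B) = directSum (star A) (star B) := by
    simp [directSum, Matrix.star_eq_conjTranspose, Matrix.fromBlocks_conjTranspose]
  rw [Matrix.mem_unitaryGroup_iff, h, directSum_mul, Matrix.mem_unitaryGroup_iff.1 hA,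
    Matrix.mem_unitaryGroup_iff.1 hB, directSum_one]

lemma directSum_sum (S : Finset (Fin N)) (T : Finset (Fin M)) (α : Fin N → ℂ) (β : Fin M → ℂ) :
    directSum (∑ i ∈ S, xiBlock α i) (∑ j ∈ T, xiBlock β j) =
      ∑ i ∈ S, block (Fin.castAdd M i) (Fin.castAdd M (finRotate N i)) (α i) +
        ∑ j ∈ T, block (Fin.natAdd N j) (Fin.natAdd N (finRotate M j)) (β j) := by
  have hlr : ∀ (i : Fin N) (j : Fin M), Fin.castAdd M i ≠ Fin.natAdd N j := fun i j h => by
    have := congrArg Fin.val h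
    rw [Fin.val_castAdd, Fin.val_natAdd] at this
    lia
  ext k l
  refine Fin.addCases (fun k => ?_) (fun k => ?_) k <;>
    refine Fin.addCases (fun l => ?_) (fun l => ?_) l <;>
    simp [directSum, Matrix.sum_apply, xiBlock_eq_block, block, Matrix.single_apply, hlr,
      (hlr _ _).symm]

/-- Splitting a sum of blocks over `Fin (N + M)`, with `N` even, into the two halves. -/
lemma sum_xiBlock_append (p : ℕ → Prop) [DecidablePred p] (hp : ∀ k, p (N + k) ↔ p k)
    (α : Fin N → ℂ) (β : Fin M → ℂ) :
    ∑ i : Fin (N + M) with p i.val, xiBlock (Fin.append α β) i =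
      ∑ i : Fin N with p i.val,
          block (Fin.castAdd M i) (finRotate (N + M) (Fin.castAdd M i)) (α i) +
        ∑ j : Fin M with p j.val,
          block (Fin.natAdd N j) (finRotate (N + M) (Fin.natAdd N j)) (β j) := by
  simp only [Finset.sum_filter, Fin.sum_univ_add, xiBlock_eq_block, Fin.append_left,
    Fin.append_right, Fin.val_castAdd, Fin.val_natAdd, hp]

lemma finRotate_castAdd {i : Fin N} (hi : i.val + 1 ≠ N) :
    finRotate (N + M) (Fin.castAdd M i) = Fin.castAdd M (finRotate N i) := by
  have := i.isLt
  ext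
  rw [val_finRotate, Fin.val_castAdd, Fin.val_castAdd, val_finRotate, if_neg hi, if_neg (by lia)]

lemma finRotate_natAdd {j : Fin M} (hj : j.val + 1 ≠ M) :
    finRotate (N + M) (Fin.natAdd N j) = Fin.natAdd N (finRotate M j) := by
  ext
  rw [val_finRotate, Fin.val_natAdd, Fin.val_natAdd, val_finRotate, if_neg hj, if_neg (by lia)]
  lia

lemma matL_append (hN : Even N) (hM : Even M) (α : Fin N → ℂ) (β : Fin M → ℂ) :
    matL (Fin.append α β) = directSum (matL α) (matL β) := by
  rw [matL, matL, matL, directSum_sum, sum_xiBlock_append _ (fun k => by simp [Nat.even_add, hN])]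
  congr 1
  · refine Finset.sum_congr rfl fun i hi => ?_
    rw [finRotate_castAdd]
    rintro h
    rw [← h, Nat.even_add_one] at hN
    exact hN (Finset.mem_filter.1 hi).2
  · refine Finset.sum_congr rfl fun j hj => ?_
    rw [finRotate_natAdd]
    rintro h
    rw [← h, Nat.even_add_one] at hM
    exact hM (Finset.mem_filter.1 hj).2

lemma sum_ite_val_add_one_le (S : Finset (Fin N)) (c : ℝ) (hc : 0 ≤ c) :
    ∑ i ∈ S, (if i.val + 1 = N then c else 0) ≤ c := by
  rw [← Finset.sum_filter, Finset.sum_const, nsmul_eq_mul]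
  have : (S.filter fun i => i.val + 1 = N).card ≤ 1 :=
    Finset.card_le_one.2 fun i hi j hj => Fin.ext (by
      have := (Finset.mem_filter.1 hi).2
      have := (Finset.mem_filter.1 hj).2
      lia)
  have : ((S.filter fun i => i.val + 1 = N).card : ℝ) ≤ 1 := by exact_mod_cast this
  nlinarith

/-- Only the two blocks that close up the cycles are different. -/
lemma norm_trace_matM_append_sub_mul_le (hN : Even N) {α : Fin N → ℂ} {β : Fin M → ℂ}
    (hα : ∀ j, ‖α j‖ ≤ 1) (hβ : ∀ j, ‖β j‖ ≤ 1) {A : Matrix (Fin (N + M)) (Fin (N + M)) ℂ}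
    (hA : ∀ i j, ‖A i j‖ ≤ 1) :
    ‖((matM (Fin.append α β) - directSum (matM α) (matM β)) * A).trace‖ ≤ 16 := by
  rw [matM, matM, matM, directSum_sum,
    sum_xiBlock_append _ (fun k => by
      rw [← Nat.not_even_iff_odd, ← Nat.not_even_iff_odd, Nat.even_add]; simp [hN]),
    add_sub_add_comm, ← Finset.sum_sub_distrib, ← Finset.sum_sub_distrib, add_mul,
    Finset.sum_mul, Finset.sum_mul, Matrix.trace_add, Matrix.trace_sum, Matrix.trace_sum]
  have key : ∀ (a b c : Fin (N + M)) (z : ℂ), ‖z‖ ≤ 1 →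
      ‖((block a b z - block a c z) * A).trace‖ ≤ 8 := fun a b c z hz => by
    rw [sub_mul, Matrix.trace_sub]
    refine (norm_sub_le _ _).trans ?_
    linarith [norm_trace_block_mul_le (i := a) (j := b) hz hA,
      norm_trace_block_mul_le (i := a) (j := c) hz hA]
  refine (norm_add_le _ _).trans ?_
  have h1 : ‖∑ i : Fin N with Odd i.val,
      ((block (Fin.castAdd M i) (finRotate (N + M) (Fin.castAdd M i)) (α i) -
        block (Fin.castAdd M i) (Fin.castAdd M (finRotate N i)) (α i)) * A).trace‖ ≤ 8 := by
    refine (norm_sum_le_of_le _ fun i _ => ?_).trans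
      (sum_ite_val_add_one_le (N := N) _ 8 (by norm_num))
    split_ifs with h
    · exact key _ _ _ _ (hα i)
    · rw [finRotate_castAdd h]; simp
  have h2 : ‖∑ j : Fin M with Odd j.val,
      ((block (Fin.natAdd N j) (finRotate (N + M) (Fin.natAdd N j)) (β j) -
        block (Fin.natAdd N j) (Fin.natAdd N (finRotate M j)) (β j)) * A).trace‖ ≤ 8 := by
    refine (norm_sum_le_of_le _ fun j _ => ?_).trans
      (sum_ite_val_add_one_le (N := M) _ 8 (by norm_num))
    split_ifs with h
    · exact key _ _ _ _ (hβ j)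
    · rw [finRotate_natAdd h]; simp
  linarith

/-- The traces of powers of the Lax matrix are additive up to a bounded error: in
`E ^ k - (E' ⊕ E'') ^ k`, expanded telescopically, each of the `k` terms contains one factor
supported on boundedly many entries, the other factors being unitary. -/
lemma norm_trace_laxMatrix_append_pow_sub_le (hN : Even N) (hM : Even M) {α : Fin N → ℂ}
    {β : Fin M → ℂ} (hα : ∀ j, ‖α j‖ ≤ 1) (hβ : ∀ j, ‖β j‖ ≤ 1) (k : ℕ) :
    ‖(laxMatrix (Fin.append α β) ^ k).trace -
      ((laxMatrix α ^ k).trace + (laxMatrix β ^ k).trace)‖ ≤ 16 * k := by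
  have hαβ : ∀ j, ‖Fin.append α β j‖ ≤ 1 := fun j => by
    refine Fin.addCases (fun i => ?_) (fun i => ?_) j
    · rw [Fin.append_left]; exact hα i
    · rw [Fin.append_right]; exact hβ i
  set E := laxMatrix (Fin.append α β) with hE
  set E' := directSum (laxMatrix α) (laxMatrix β) with hE'
  have hL := matL_mem_unitaryGroup (hN.add hM) hαβ
  have hEu : E ∈ Matrix.unitaryGroup _ ℂ := laxMatrix_mem_unitaryGroup (hN.add hM) hαβ
  have hEu' : E' ∈ Matrix.unitaryGroup _ ℂ := directSum_mem_unitaryGroup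
    (laxMatrix_mem_unitaryGroup hN hα) (laxMatrix_mem_unitaryGroup hM hβ)
  have hdiff : E - E' = matL (Fin.append α β) *
      (matM (Fin.append α β) - directSum (matM α) (matM β)) := by
    rw [hE, hE', laxMatrix, laxMatrix, laxMatrix, ← directSum_mul, ← matL_append hN hM, mul_sub]
  have key : ∀ (k : ℕ) (W : Matrix (Fin (N + M)) (Fin (N + M)) ℂ),
      W ∈ Matrix.unitaryGroup _ ℂ → ‖((E ^ k - E' ^ k) * W).trace‖ ≤ 16 * k := by
    intro k
    induction k with
    | zero => simp
    | succ k ih =>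
      intro W hW
      have e : (E ^ (k + 1) - E' ^ (k + 1)) * W =
          E ^ k * matL (Fin.append α β) *
            ((matM (Fin.append α β) - directSum (matM α) (matM β)) * W) +
          (E ^ k - E' ^ k) * (E' * W) := by
        rw [mul_assoc (E ^ k), ← mul_assoc (matL _), ← hdiff, pow_succ, pow_succ]
        noncomm_ring
      rw [e, Matrix.trace_add, Matrix.trace_mul_comm, mul_assoc]
      refine (norm_add_le _ _).trans ?_
      have h1 := norm_trace_matM_append_sub_mul_le hN hα hβ (A := W * (E ^ k * matL _))
        (entry_norm_bound_of_unitary (mul_mem hW (mul_mem (pow_mem hEu k) hL)))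
      have h2 := ih (E' * W) (mul_mem hEu' hW)
      push_cast
      linarith
  have := key k 1 (one_mem _)
  rwa [mul_one, Matrix.trace_sub, hE', directSum_pow, trace_directSum] at this

end DirectSum

/-! ### The laws of the coefficients -/

/-- The integrand is unbounded near `1` if `β < 1`; it is integrable as the nonnegative derivative
of a function continuous up to the boundary. -/
lemma integral_mul_one_sub_sq_rpow {β : ℝ} (hβ : 0 < β) :
    IntegrableOn (fun y : ℝ => y * (1 - y ^ 2) ^ (β - 1)) (Set.Ioo 0 1) ∧
      ∫ y in Set.Ioo (0 : ℝ) 1, y * (1 - y ^ 2) ^ (β - 1) = 1 / (2 * β) := by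
  have hcont : ContinuousOn (fun y : ℝ => -(1 - y ^ 2) ^ β / (2 * β)) (Set.Icc 0 1) := by
    refine Continuous.continuousOn ?_
    exact ((Continuous.rpow_const (by fun_prop) fun _ => Or.inr hβ.le).neg).div_const _
  have hderiv : ∀ y ∈ Set.Ioo (0 : ℝ) 1,
      HasDerivAt (fun y : ℝ => -(1 - y ^ 2) ^ β / (2 * β)) (y * (1 - y ^ 2) ^ (β - 1)) y := by
    intro y hy
    have h1 : 1 - y ^ 2 ≠ 0 := by nlinarith [hy.1, hy.2]
    have h2 : HasDerivAt (fun y : ℝ => 1 - y ^ 2) (-(2 * y)) y := by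
      simpa using (hasDerivAt_pow 2 y).const_sub 1
    refine ((h2.rpow_const (p := β) (Or.inl h1)).neg.div_const (2 * β)).congr_deriv ?_
    field_simp
  have hint := intervalIntegral.integrableOn_deriv_of_nonneg hcont hderiv fun y hy =>
    mul_nonneg hy.1.le (Real.rpow_nonneg (by nlinarith [hy.1, hy.2]) _)
  refine ⟨hint.mono_set Set.Ioo_subset_Ioc_self, ?_⟩
  rw [← integral_Ioc_eq_integral_Ioo, ← intervalIntegral.integral_of_le zero_le_one,
    intervalIntegral.integral_eq_sub_of_hasDerivAt_of_le zero_le_one hcont hderiv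
      ((intervalIntegrable_iff_integrableOn_Ioc_of_le zero_le_one).2 hint)]
  simp [Real.zero_rpow hβ.ne']
  ring

/-- The measure `(1 - |z|²)^{β-1} d²z` on the unit disk. -/
noncomputable def diskMeasure (β : ℝ) : Measure ℂ :=
  (volume.restrict (Metric.ball (0 : ℂ) 1)).withDensity fun z =>
    ENNReal.ofReal ((1 - ‖z‖ ^ 2) ^ (β - 1))

lemma diskMeasure_univ {β : ℝ} (hβ : 0 < β) :
    diskMeasure β Set.univ = ENNReal.ofReal (Real.pi / β) := by
  obtain ⟨hint, hval⟩ := integral_mul_one_sub_sq_rpow hβ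
  set f : ℝ → ℝ := fun y => (1 - y ^ 2) ^ (β - 1) with hf
  have hi : IntegrableOn (fun z : ℂ => f ‖z‖) (Metric.ball 0 1) := by
    rw [integrableOn_fun_norm_addHaar]
    simpa [Complex.finrank_real_complex] using hint
  have hI : ∫ z in Metric.ball (0 : ℂ) 1, f ‖z‖ = Real.pi / β := by
    have h1 : ∫ z in Metric.ball (0 : ℂ) 1, f ‖z‖ =
        ∫ z : ℂ, (Set.Iio (1 : ℝ)).indicator f ‖z‖ := by
      rw [← integral_indicator measurableSet_ball]
      refine integral_congr_ae (ae_of_all _ fun z => ?_)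
      simp [Set.indicator]
    rw [h1, integral_fun_norm_addHaar volume ((Set.Iio (1 : ℝ)).indicator f)]
    have h2 : ∫ y in Set.Ioi (0 : ℝ), y ^ (Module.finrank ℝ ℂ - 1) •
        (Set.Iio (1 : ℝ)).indicator f y = ∫ y in Set.Ioo (0 : ℝ) 1, y * f y := by
      rw [← Set.Ioi_inter_Iio, Set.inter_comm, ← Measure.restrict_restrict measurableSet_Iio,
        ← integral_indicator measurableSet_Iio]
      refine integral_congr_ae (ae_of_all _ fun y => ?_)
      by_cases hy : y < 1 <;> simp [Set.indicator, hy, Complex.finrank_real_complex]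
    rw [h2, hval]
    simp [Measure.real, Complex.finrank_real_complex]
    field_simp
  rw [diskMeasure, withDensity_apply _ MeasurableSet.univ, Measure.restrict_univ,
    ← ofReal_integral_eq_lintegral_ofReal hi ?_, hI]
  filter_upwards [ae_restrict_mem measurableSet_ball] with z hz
  have : ‖z‖ < 1 := by simpa using hz
  exact Real.rpow_nonneg (by nlinarith [norm_nonneg z]) _

lemma thetaLaw_eq {β : ℝ} (hβ : 0 < β) :
    thetaLaw (2 * β + 1) = (ENNReal.ofReal (Real.pi / β))⁻¹ • diskMeasure β := by
  have hball : (volume.restrict (Metric.closedBall (0 : ℂ) 1)) =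
      volume.restrict (Metric.ball (0 : ℂ) 1) := by
    refine Measure.restrict_congr_set ?_
    rw [← Metric.ball_union_sphere]
    exact union_ae_eq_left_of_ae_eq_empty (ae_eq_empty.2 (Measure.addHaar_sphere _ _ _))
  rw [thetaLaw, diskMeasure, hball, ← withDensity_smul _ (by fun_prop)]
  congr 1
  funext z
  rw [Pi.smul_apply, smul_eq_mul, ← ENNReal.ofReal_inv_of_pos (by positivity),
    ← ENNReal.ofReal_mul (by positivity)]
  congr 2
  · field_simp; ring
  · ring_nf

instance isFiniteMeasure_diskMeasure {β : ℝ} [hβ : Fact (0 < β)] :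
    IsFiniteMeasure (diskMeasure β) :=
  ⟨by rw [diskMeasure_univ hβ.out]; exact ENNReal.ofReal_lt_top⟩

lemma isProbabilityMeasure_thetaLaw {β : ℝ} (hβ : 0 < β) :
    IsProbabilityMeasure (thetaLaw (2 * β + 1)) := by
  constructor
  rw [thetaLaw_eq hβ, Measure.smul_apply, diskMeasure_univ hβ, smul_eq_mul]
  exact ENNReal.inv_mul_cancel (by simpa using div_pos Real.pi_pos hβ) ENNReal.ofReal_ne_top

/-- The open polydisk, on which all the laws live. -/
def polydisk (N : ℕ) : Set (Fin N → ℂ) := {α | ∀ j, ‖α j‖ < 1}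

lemma polydisk_eq_pi (N : ℕ) : polydisk N = Set.univ.pi fun _ => Metric.ball (0 : ℂ) 1 := by
  ext; simp [polydisk]

lemma measurableSet_polydisk (N : ℕ) : MeasurableSet (polydisk N) := by
  rw [polydisk_eq_pi]
  exact MeasurableSet.univ_pi fun _ => measurableSet_ball

/-- **Tonelli's theorem** for a product of nonnegative functions of one variable each. -/
lemma lintegral_fin_prod_eq_prod {E : Type*} [MeasurableSpace E] {N : ℕ} (μ : Fin N → Measure E)
    [∀ i, SigmaFinite (μ i)] {f : E → ℝ≥0∞} (hf : Measurable f) :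
    ∫⁻ x : Fin N → E, ∏ i, f (x i) ∂(Measure.pi μ) = ∏ i, ∫⁻ x, f x ∂(μ i) := by
  induction N with
  | zero => simp
  | succ N ih =>
    rw [← ((measurePreserving_piFinSuccAbove μ 0).symm).lintegral_comp (by fun_prop)]
    simp only [MeasurableEquiv.piFinSuccAbove_symm_apply, Fin.insertNthEquiv,
      Fin.prod_univ_succ, Fin.insertNth_zero, Equiv.coe_fn_mk, Fin.cons_succ,
      Fin.zero_succAbove, Fin.cons_zero, cast_eq]
    rw [lintegral_prod_mul (g := fun y : Fin N → E => ∏ i, f (y i)) hf.aemeasurable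
      (Finset.measurable_fun_prod _ fun i _ => hf.comp (measurable_pi_apply i)).aemeasurable, ih]

lemma gibbsUnnormalised_zero {β : ℝ} (hβ : 0 < β) (N : ℕ) :
    gibbsUnnormalised β 0 N = Measure.pi fun _ => diskMeasure β := by
  have : Fact (0 < β) := ⟨hβ⟩
  refine (Measure.pi_eq fun s hs => ?_).symm
  have hd : ∀ᵐ α ∂((volume.restrict (polydisk N)).restrict (Set.univ.pi s)),
      ENNReal.ofReal ((∏ j, (1 - ‖α j‖ ^ 2) ^ (β - 1)) *
        Real.exp (-traceFun 0 (laxMatrix α))) =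
      ∏ j, ENNReal.ofReal ((1 - ‖α j‖ ^ 2) ^ (β - 1)) := by
    refine ae_restrict_of_ae ?_
    filter_upwards [ae_restrict_mem (measurableSet_polydisk N)] with α hα
    have h0 : traceFun 0 (laxMatrix α) = 0 := by simp [traceFun]
    rw [h0, neg_zero, Real.exp_zero, mul_one, ENNReal.ofReal_prod_of_nonneg]
    intro j _
    exact Real.rpow_nonneg (by nlinarith [norm_nonneg (α j), hα j]) _
  have hr : (volume.restrict (polydisk N)).restrict (Set.univ.pi s) =
      Measure.pi fun i => (volume.restrict (Metric.ball (0 : ℂ) 1)).restrict (s i) := by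
    rw [polydisk_eq_pi, volume_pi, Measure.restrict_pi_pi, Measure.restrict_pi_pi]
  rw [gibbsUnnormalised, withDensity_apply _ (MeasurableSet.univ_pi hs)]
  change ∫⁻ α in Set.univ.pi s, _ ∂(volume.restrict (polydisk N)) = _
  rw [lintegral_congr_ae hd, hr, lintegral_fin_prod_eq_prod
    (f := fun z : ℂ => ENNReal.ofReal ((1 - ‖z‖ ^ 2) ^ (β - 1))) _ (by fun_prop)]
  refine Finset.prod_congr rfl fun i _ => ?_
  rw [diskMeasure, withDensity_apply _ (hs i)]

lemma partitionFunction_zero {β : ℝ} (hβ : 0 < β) (N : ℕ) :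
    partitionFunction β 0 N = ENNReal.ofReal (Real.pi / β) ^ N := by
  have : Fact (0 < β) := ⟨hβ⟩
  rw [partitionFunction, gibbsUnnormalised_zero hβ, Measure.pi_univ]
  simp [diskMeasure_univ hβ]

lemma partitionFunction_zero_ne_zero {β : ℝ} (hβ : 0 < β) (N : ℕ) :
    partitionFunction β 0 N ≠ 0 := by
  rw [partitionFunction_zero hβ]
  exact pow_ne_zero _ (by simpa using div_pos Real.pi_pos hβ)

lemma partitionFunction_zero_ne_top {β : ℝ} (hβ : 0 < β) (N : ℕ) :
    partitionFunction β 0 N ≠ ⊤ := by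
  rw [partitionFunction_zero hβ]
  exact ENNReal.pow_ne_top ENNReal.ofReal_ne_top

theorem gibbs_zero {β : ℝ} (hβ : 0 < β) (N : ℕ) : gibbs β 0 N = iidLaw β N := by
  have : Fact (0 < β) := ⟨hβ⟩
  have := isProbabilityMeasure_thetaLaw hβ
  rw [gibbs, partitionFunction_zero hβ, gibbsUnnormalised_zero hβ, iidLaw]
  refine (Measure.pi_eq fun s hs => ?_).symm
  simp only [thetaLaw_eq hβ, Measure.smul_apply, Measure.pi_pi, smul_eq_mul,
    Finset.prod_mul_distrib, Finset.prod_const, Finset.card_univ, Fintype.card_fin,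
    ENNReal.inv_pow]

lemma isProbabilityMeasure_iidLaw {β : ℝ} (hβ : 0 < β) (N : ℕ) :
    IsProbabilityMeasure (iidLaw β N) := by
  have := isProbabilityMeasure_thetaLaw hβ
  rw [iidLaw]; infer_instance

lemma gibbsUnnormalised_inter_polydisk (β : ℝ) (V : Circle → ℝ) (N : ℕ) (A : Set (Fin N → ℂ)) :
    gibbsUnnormalised β V N (A ∩ polydisk N) = gibbsUnnormalised β V N A := by
  refine measure_inter_conull ?_
  rw [gibbsUnnormalised]
  refine withDensity_absolutelyContinuous _ _ ?_
  exact ae_restrict_mem (measurableSet_polydisk N)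

lemma iidLaw_eq_smul {β : ℝ} (hβ : 0 < β) (N : ℕ) :
    iidLaw β N = (partitionFunction β 0 N)⁻¹ • gibbsUnnormalised β 0 N :=
  (gibbs_zero hβ N).symm

lemma iidLaw_inter_polydisk {β : ℝ} (hβ : 0 < β) (N : ℕ) (A : Set (Fin N → ℂ)) :
    iidLaw β N (A ∩ polydisk N) = iidLaw β N A := by
  rw [iidLaw_eq_smul hβ, Measure.smul_apply, Measure.smul_apply, gibbsUnnormalised_inter_polydisk]

/-- Independent coefficients: a set of concatenations has at least the product probability. -/
lemma iidLaw_mul_le {β : ℝ} (hβ : 0 < β) {N M : ℕ} {A : Set (Fin N → ℂ)} {B : Set (Fin M → ℂ)}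
    {D : Set (Fin (N + M) → ℂ)} (h : ∀ α ∈ A, ∀ α' ∈ B, Fin.append α α' ∈ D) :
    iidLaw β N A * iidLaw β M B ≤ iidLaw β (N + M) D := by
  have := isProbabilityMeasure_thetaLaw hβ
  have h1 := measurePreserving_sumPiEquivProdPi_symm
    (fun _ : Fin N ⊕ Fin M => thetaLaw (2 * β + 1))
  have h2 := measurePreserving_piCongrLeft (fun _ : Fin (N + M) => thetaLaw (2 * β + 1))
    (finSumFinEquiv (m := N) (n := M))
  rw [iidLaw, iidLaw, iidLaw, ← Measure.prod_prod, ← (h1.trans h2).measure_preimage_equiv]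
  refine measure_mono ?_
  rintro ⟨α, α'⟩ ⟨hα, hα'⟩
  have e : (MeasurableEquiv.sumPiEquivProdPi fun _ : Fin N ⊕ Fin M => ℂ).symm.trans
      (MeasurableEquiv.piCongrLeft (fun _ : Fin (N + M) => ℂ) finSumFinEquiv) (α, α') =
        Fin.append α α' := by
    rw [MeasurableEquiv.trans_apply, MeasurableEquiv.coe_piCongrLeft]
    ext j
    refine Fin.addCases (fun i => ?_) (fun i => ?_) j
    · rw [Fin.append_left, ← finSumFinEquiv_apply_left, Equiv.piCongrLeft_apply_apply]
      rfl
    · rw [Fin.append_right, ← finSumFinEquiv_apply_right, Equiv.piCongrLeft_apply_apply]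
      rfl
  rw [Set.mem_preimage, e]
  exact h α hα α' hα'

/-- Bounds on the potential give bounds on the density with respect to the case `V = 0`. -/
lemma ofReal_exp_mul_gibbsUnnormalised_le {β : ℝ} {V : Circle → ℝ} {N : ℕ}
    {A : Set (Fin N → ℂ)} (hA : MeasurableSet A) (hAD : A ⊆ polydisk N) {c : ℝ}
    (h : ∀ α ∈ A, traceFun V (laxMatrix α) ≤ c * N) :
    ENNReal.ofReal (Real.exp (-(c * N))) * gibbsUnnormalised β 0 N A ≤
      gibbsUnnormalised β V N A := by
  rw [gibbsUnnormalised, gibbsUnnormalised, withDensity_apply _ hA, withDensity_apply _ hA,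
    ← lintegral_const_mul' _ _ ENNReal.ofReal_ne_top]
  refine setLIntegral_mono' hA fun α hα => ?_
  have h0 : traceFun 0 (laxMatrix α) = 0 := by simp [traceFun]
  have hp : 0 ≤ ∏ j, (1 - ‖α j‖ ^ 2) ^ (β - 1) := Finset.prod_nonneg fun j _ =>
    Real.rpow_nonneg (by nlinarith [norm_nonneg (α j), hAD hα j]) _
  rw [h0, neg_zero, Real.exp_zero, mul_one, ← ENNReal.ofReal_mul (Real.exp_pos _).le, mul_comm]
  gcongr
  exact h α hα

lemma gibbsUnnormalised_le_ofReal_exp_mul {β : ℝ} {V : Circle → ℝ} {N : ℕ}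
    {A : Set (Fin N → ℂ)} (hA : MeasurableSet A) (hAD : A ⊆ polydisk N) {c : ℝ}
    (h : ∀ α ∈ A, c * N ≤ traceFun V (laxMatrix α)) :
    gibbsUnnormalised β V N A ≤
      ENNReal.ofReal (Real.exp (-(c * N))) * gibbsUnnormalised β 0 N A := by
  rw [gibbsUnnormalised, gibbsUnnormalised, withDensity_apply _ hA, withDensity_apply _ hA,
    ← lintegral_const_mul' _ _ ENNReal.ofReal_ne_top]
  refine setLIntegral_mono' hA fun α hα => ?_
  have h0 : traceFun 0 (laxMatrix α) = 0 := by simp [traceFun]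
  have hp : 0 ≤ ∏ j, (1 - ‖α j‖ ^ 2) ^ (β - 1) := Finset.prod_nonneg fun j _ =>
    Real.rpow_nonneg (by nlinarith [norm_nonneg (α j), hAD hα j]) _
  rw [h0, neg_zero, Real.exp_zero, mul_one, ← ENNReal.ofReal_mul (Real.exp_pos _).le,
    mul_comm (Real.exp _)]
  gcongr
  exact h α hα

/-! ### The large deviations principles for the Lax matrix -/

lemma continuous_laxMatrix (N : ℕ) :
    Continuous fun α : Fin N → ℂ => laxMatrix α := by
  have hrho : Continuous rho := by unfold rho; fun_prop
  have hxi : ∀ j : Fin N, Continuous fun α : Fin N → ℂ => xiBlock α j := fun j => by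
    refine continuous_matrix fun k l => ?_
    simp only [xiBlock, Matrix.add_apply, Matrix.single_apply]
    have h1 : Continuous fun α : Fin N → ℂ => (rho (α j) : ℂ) :=
      Complex.continuous_ofReal.comp (hrho.comp (continuous_apply j))
    have h2 : Continuous fun α : Fin N → ℂ => conj (α j) :=
      Complex.continuous_conj.comp (continuous_apply j)
    refine ((Continuous.add ?_ ?_).add ?_).add ?_ <;> split_ifs <;> fun_prop
  have hL : Continuous fun α : Fin N → ℂ => matL α := continuous_finsetSum _ fun j _ => hxi j
  have hM : Continuous fun α : Fin N → ℂ => matM α := continuous_finsetSum _ fun j _ => hxi j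
  exact hL.matrix_mul hM

/-- The empirical measure of the eigenvalues of the Lax matrix, as a function of the
coefficients. -/
noncomputable def laxEmpirical (N : ℕ) (α : Fin N → ℂ) : ProbabilityMeasure Circle :=
  empiricalMeasure (laxMatrix α)

lemma natCast_mul_circleMoment_laxEmpirical {N : ℕ} (hN : Even N) {α : Fin N → ℂ}
    (hα : α ∈ polydisk N) (k : ℕ) :
    (N : ℂ) * circleMoment k (laxEmpirical N α) = (laxMatrix α ^ k).trace :=
  natCast_mul_circleMoment (laxMatrix_mem_unitaryGroup hN fun j => (hα j).le) k

/-- On the polydisk the moments are traces of powers, which are continuous in the coefficients;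
elsewhere the Lax matrix need not be unitary. -/
lemma measurableSet_laxEmpirical_preimage {N : ℕ} (hN : Even N) (μ : ProbabilityMeasure Circle)
    (r : ℝ) :
    MeasurableSet (laxEmpirical N ⁻¹' momentNhd circleMoment μ r ∩ polydisk N) := by
  rcases N.eq_zero_or_pos with rfl | h0
  · exact (Set.toFinite _).measurableSet
  have e : laxEmpirical N ⁻¹' momentNhd circleMoment μ r ∩ polydisk N =
      {α | ∀ k : ℕ, ‖(laxMatrix α ^ k).trace - N * circleMoment k μ‖ ≤ N * r * (k + 1)} ∩
        polydisk N := by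
    rw [preimage_momentNhd h0]
    ext α
    refine and_congr_left fun hα => forall_congr' fun k => ?_
    rw [natCast_mul_circleMoment_laxEmpirical hN hα]
  rw [e]
  refine MeasurableSet.inter ?_ (measurableSet_polydisk N)
  rw [Set.ofPred_forall]
  refine MeasurableSet.iInter fun k => (isClosed_le ?_ continuous_const).measurableSet
  exact ((((continuous_laxMatrix N).pow k).matrix_trace).sub continuous_const).norm

theorem isSuperadditive_iidLaw {β : ℝ} (hβ : 0 < β) :
    IsSuperadditive (iidLaw β) laxEmpirical circleMoment 16 := by
  intro N M hN hM u v a b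
  rw [← iidLaw_inter_polydisk hβ N, ← iidLaw_inter_polydisk hβ M]
  refine iidLaw_mul_le hβ fun α hα α' hα' k => ?_
  have hp : Fin.append α α' ∈ polydisk (N + M) := fun j => by
    refine Fin.addCases (fun i => ?_) (fun i => ?_) j
    · rw [Fin.append_left]; exact hα.2 i
    · rw [Fin.append_right]; exact hα'.2 i
  have h1 := hα.1 k
  have h2 := hα'.1 k
  have h3 := norm_trace_laxMatrix_append_pow_sub_le hN hM (fun j => (hα.2 j).le)
    (fun j => (hα'.2 j).le) k
  rw [natCast_mul_circleMoment_laxEmpirical hN hα.2] at h1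
  rw [natCast_mul_circleMoment_laxEmpirical hM hα'.2] at h2
  rw [natCast_mul_circleMoment_laxEmpirical (hN.add hM) hp]
  set S := (laxMatrix (Fin.append α α') ^ k).trace
  set T := (laxMatrix α ^ k).trace
  set T' := (laxMatrix α' ^ k).trace
  calc ‖S - (u k + v k)‖ = ‖S - (T + T') + (T - u k) + (T' - v k)‖ := by ring_nf
    _ ≤ ‖S - (T + T')‖ + ‖T - u k‖ + ‖T' - v k‖ := norm_add₃_le
    _ ≤ (a + b + 16) * (k + 1) := by linarith

lemma continuous_integral_probabilityMeasure {V : Circle → ℝ} (hV : Continuous V) :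
    Continuous fun μ : ProbabilityMeasure Circle => ∫ z, V z ∂(μ : Measure Circle) :=
  ProbabilityMeasure.continuous_integral_boundedContinuousFunction
    (BoundedContinuousFunction.mkOfCompact ⟨V, hV⟩)

lemma exists_abs_integral_le {V : Circle → ℝ} (hV : Continuous V) :
    ∃ C : ℝ, ∀ μ : ProbabilityMeasure Circle, |∫ z, V z ∂(μ : Measure Circle)| ≤ C := by
  obtain ⟨C, hC⟩ := isCompact_univ.exists_bound_of_continuousOn
    (continuous_integral_probabilityMeasure hV).continuousOn
  exact ⟨C, fun μ => hC μ (Set.mem_univ _)⟩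

lemma isProbabilityMeasure_gibbs {β : ℝ} (hβ : 0 < β) {V : Circle → ℝ} (hV : Continuous V)
    (N : ℕ) : IsProbabilityMeasure (gibbs β V N) := by
  obtain ⟨C, hC⟩ := exists_abs_integral_le hV
  have hN : (0 : ℝ) ≤ N := Nat.cast_nonneg N
  have hlow := ofReal_exp_mul_gibbsUnnormalised_le (β := β) (V := V) (measurableSet_polydisk N)
    subset_rfl (c := C) fun α _ => by
      rw [traceFun_eq]
      nlinarith [(abs_le.1 (hC (empiricalMeasure (laxMatrix α)))).2]
  have hupp := gibbsUnnormalised_le_ofReal_exp_mul (β := β) (V := V) (measurableSet_polydisk N)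
    subset_rfl (c := -C) fun α _ => by
      rw [traceFun_eq]
      nlinarith [(abs_le.1 (hC (empiricalMeasure (laxMatrix α)))).1]
  have hD : ∀ V, gibbsUnnormalised β V N (polydisk N) = partitionFunction β V N := fun V => by
    rw [partitionFunction, ← gibbsUnnormalised_inter_polydisk _ _ _ Set.univ, Set.univ_inter]
  rw [hD, hD] at hlow hupp
  constructor
  rw [gibbs, Measure.smul_apply, smul_eq_mul]
  refine ENNReal.inv_mul_cancel (fun h0 => ?_) (fun htop => ?_)
  · have h1 : partitionFunction β V N = 0 := h0
    rw [h1, nonpos_iff_eq_zero, mul_eq_zero] at hlow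
    exact hlow.elim (by simp [Real.exp_pos]) (partitionFunction_zero_ne_zero hβ N)
  · have h1 : partitionFunction β V N = ⊤ := htop
    rw [h1, top_le_iff] at hupp
    exact ENNReal.mul_ne_top ENNReal.ofReal_ne_top (partitionFunction_zero_ne_top hβ N) hupp

/-- Adding a potential to a local rate of the independent coefficients. -/
theorem isLocalRate_smul_gibbsUnnormalised {β : ℝ} (hβ : 0 < β)
    {J : ProbabilityMeasure Circle → EReal} (hJ : IsLocalRate (iidLaw β) laxEmpirical J)
    {V : Circle → ℝ} (hV : Continuous V) :
    IsLocalRate (fun N => (partitionFunction β 0 N)⁻¹ • gibbsUnnormalised β V N) laxEmpirical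
      (freeEnergy J V) := by
  refine hJ.tilt (continuous_integral_probabilityMeasure hV)
    (Set.range fun p : ProbabilityMeasure Circle × ℝ => momentNhd circleMoment p.1 p.2)
    (fun μ U hU => ?_) ?_ ?_
  · obtain ⟨r, hr, hrU⟩ := exists_momentNhd_subset continuous_circleMoment eq_of_circleMoment_eq
      μ hU
    exact ⟨_, ⟨(μ, r), rfl⟩,
      momentNhd_mem_nhds continuous_circleMoment norm_circleMoment_le μ hr, hrU⟩
  · rintro N hN _ ⟨⟨μ, r⟩, rfl⟩ c hc
    rw [iidLaw_eq_smul hβ, Measure.smul_apply, Measure.smul_apply, smul_eq_mul, smul_eq_mul,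
      mul_left_comm, ← gibbsUnnormalised_inter_polydisk, ← gibbsUnnormalised_inter_polydisk β V]
    gcongr
    refine ofReal_exp_mul_gibbsUnnormalised_le (measurableSet_laxEmpirical_preimage hN μ r)
      Set.inter_subset_right fun α hα => ?_
    rw [traceFun_eq, mul_comm]
    gcongr
    exact hc _ hα.1
  · rintro N hN _ ⟨⟨μ, r⟩, rfl⟩ c hc
    rw [iidLaw_eq_smul hβ, Measure.smul_apply, Measure.smul_apply, smul_eq_mul, smul_eq_mul,
      mul_left_comm, ← gibbsUnnormalised_inter_polydisk, ← gibbsUnnormalised_inter_polydisk β 0]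
    gcongr
    refine gibbsUnnormalised_le_ofReal_exp_mul (measurableSet_laxEmpirical_preimage hN μ r)
      Set.inter_subset_right fun α hα => ?_
    rw [traceFun_eq, mul_comm]
    gcongr
    exact hc _ hα.1

/-- The Gibbs measure is also the normalisation of the unnormalised one divided by the partition
function of the independent case. -/
lemma gibbs_eq_inv_smul {β : ℝ} (hβ : 0 < β) (V : Circle → ℝ) (N : ℕ) :
    gibbs β V N = (((partitionFunction β 0 N)⁻¹ • gibbsUnnormalised β V N) Set.univ)⁻¹ •
      ((partitionFunction β 0 N)⁻¹ • gibbsUnnormalised β V N) := by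
  have h0 := partitionFunction_zero_ne_zero hβ N
  have ht := partitionFunction_zero_ne_top hβ N
  rw [gibbs, Measure.smul_apply, smul_eq_mul, smul_smul,
    ENNReal.mul_inv (Or.inl (ENNReal.inv_ne_zero.2 ht)) (Or.inl (ENNReal.inv_ne_top.2 h0)),
    inv_inv, mul_right_comm, ENNReal.mul_inv_cancel h0 ht, one_mul]
  rfl

lemma exists_iInf_freeEnergy_eq {J : ProbabilityMeasure Circle → EReal} (hJ : ∀ μ, 0 ≤ J μ)
    (hJt : ∃ μ, J μ ≠ ⊤) {V : Circle → ℝ} (hV : Continuous V) :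
    ∃ c : ℝ, ⨅ μ, freeEnergy J V μ = (c : EReal) := by
  obtain ⟨C, hC⟩ := exists_abs_integral_le hV
  obtain ⟨μ, hμ⟩ := hJt
  have h1 : ((-C : ℝ) : EReal) ≤ ⨅ μ, freeEnergy J V μ := by
    refine le_iInf fun μ => ?_
    rw [freeEnergy, ← zero_add ((-C : ℝ) : EReal)]
    exact add_le_add (hJ μ) (EReal.coe_le_coe_iff.2 (abs_le.1 (hC μ)).1)
  have h2 : ⨅ μ, freeEnergy J V μ < ⊤ :=
    (iInf_le _ μ).trans_lt (EReal.add_lt_top hμ (EReal.coe_ne_top _))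
  exact ⟨_, (EReal.coe_toReal h2.ne (ne_bot_of_le_ne_bot (EReal.coe_ne_bot _) h1)).symm⟩

lemma tiltedRate_nonneg {J : ProbabilityMeasure Circle → EReal} {V : Circle → ℝ} {c : ℝ}
    (hc : ⨅ μ, freeEnergy J V μ = (c : EReal)) (μ : ProbabilityMeasure Circle) :
    0 ≤ tiltedRate J V μ := by
  rw [tiltedRate, hc, EReal.sub_nonneg (Or.inr (EReal.coe_ne_top _)) (Or.inr (EReal.coe_ne_bot _)),
    ← hc]
  exact iInf_le _ μ

lemma isConvexOnProb_tiltedRate {J : ProbabilityMeasure Circle → EReal} (hJ : IsConvexOnProb J)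
    {V : Circle → ℝ} (hV : Continuous V) {c : ℝ} (hc : ⨅ μ, freeEnergy J V μ = (c : EReal)) :
    IsConvexOnProb (tiltedRate J V) := by
  intro μ ν κ a b hab hκ
  have hint : ∀ μ : ProbabilityMeasure Circle, Integrable V (μ : Measure Circle) := fun μ =>
    hV.integrable_of_hasCompactSupport (HasCompactSupport.of_compactSpace _)
  set F : ProbabilityMeasure Circle → ℝ := fun μ => ∫ z, V z ∂(μ : Measure Circle) with hF
  have hFκ : F κ = a * F μ + b * F ν := by
    simp only [hF]
    rw [hκ, integral_add_measure (hint μ).smul_measure_nnreal (hint ν).smul_measure_nnreal,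
      integral_smul_nnreal_measure, integral_smul_nnreal_measure]
    rfl
  have hrw : ∀ μ, tiltedRate J V μ = J μ + ((F μ - c : ℝ) : EReal) := fun μ => by
    rw [tiltedRate, hc, freeEnergy, sub_eq_add_neg, add_assoc, ← EReal.coe_neg, ← EReal.coe_add,
      ← sub_eq_add_neg]
  have hreal : F κ - c = a * (F μ - c) + b * (F ν - c) := by
    have : (a : ℝ) + b = 1 := by exact_mod_cast hab
    rw [hFκ]; linear_combination c * this
  have hmul : ∀ (t : ℝ≥0) (x : EReal) (y : ℝ),
      ((t : ℝ) : EReal) * (x + y) = ((t : ℝ) : EReal) * x + ((t * y : ℝ) : EReal) :=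
    fun t x y => by
      rw [EReal.left_distrib_of_nonneg_of_ne_top (EReal.coe_nonneg.2 (NNReal.coe_nonneg t))
        (EReal.coe_ne_top _),
        EReal.coe_mul]
  rw [hrw, hrw, hrw, hmul, hmul, hreal, add_add_add_comm, ← EReal.coe_add]
  exact add_le_add_left (hJ μ ν κ a b hab hκ) _

lemma circleMoment_convex {μ ν κ : ProbabilityMeasure Circle} {a b : ℝ≥0}
    (hκ : (κ : Measure Circle) = a • (μ : Measure Circle) + b • (ν : Measure Circle)) (k : ℕ) :
    circleMoment k κ = (a : ℝ) * circleMoment k μ + (b : ℝ) * circleMoment k ν := by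
  have hint : ∀ μ : ProbabilityMeasure Circle,
      Integrable (fun z : Circle => (z : ℂ) ^ k) (μ : Measure Circle) := fun μ =>
    Continuous.integrable_of_hasCompactSupport (by fun_prop)
      (HasCompactSupport.of_compactSpace _)
  rw [circleMoment, hκ, integral_add_measure (hint μ).smul_measure_nnreal
    (hint ν).smul_measure_nnreal, integral_smul_nnreal_measure, integral_smul_nnreal_measure]
  rfl

end AblowitzLadik

theorem corollary2p4 (β : ℝ) (hβ : 0 < β) :
    -- for `V = 0` the coefficients are i.i.d. with law `Θ_{2β+1}`
    (∀ N : ℕ, AblowitzLadik.gibbs β 0 N = AblowitzLadik.iidLaw β N) ∧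
    -- the rate function `J = J_β` of the case `V = 0`
    ∃ J : ProbabilityMeasure Circle → EReal,
      AblowitzLadik.IsGoodRateFunction J ∧
      AblowitzLadik.IsConvexOnProb J ∧
      AblowitzLadik.SatisfiesLDP (AblowitzLadik.iidLaw β)
        (fun _ α => AblowitzLadik.empiricalMeasure (AblowitzLadik.laxMatrix α)) J ∧
      (∀ J' : ProbabilityMeasure Circle → EReal,
        AblowitzLadik.IsGoodRateFunction J' →
        AblowitzLadik.SatisfiesLDP (AblowitzLadik.iidLaw β)
          (fun _ α => AblowitzLadik.empiricalMeasure (AblowitzLadik.laxMatrix α)) J' →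
        J' = J) ∧
      -- the large deviations principle with a continuous potential `V`
      ∀ V : Circle → ℝ, Continuous V →
        (∀ N : ℕ, Even N → IsProbabilityMeasure (AblowitzLadik.gibbs β V N)) ∧
        AblowitzLadik.IsGoodRateFunction (AblowitzLadik.tiltedRate J V) ∧
        AblowitzLadik.IsConvexOnProb (AblowitzLadik.tiltedRate J V) ∧
        AblowitzLadik.SatisfiesLDP (AblowitzLadik.gibbs β V)
          (fun _ α => AblowitzLadik.empiricalMeasure (AblowitzLadik.laxMatrix α))
          (AblowitzLadik.tiltedRate J V) := by

  have hprob := AblowitzLadik.isProbabilityMeasure_iidLaw hβ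
  have hsup := AblowitzLadik.isSuperadditive_iidLaw hβ
  set J := AblowitzLadik.decayRate (AblowitzLadik.iidLaw β) AblowitzLadik.laxEmpirical
    AblowitzLadik.circleMoment
  have hJ : AblowitzLadik.IsLocalRate (AblowitzLadik.iidLaw β) AblowitzLadik.laxEmpirical J :=
    hsup.isLocalRate_decayRate AblowitzLadik.continuous_circleMoment
      AblowitzLadik.norm_circleMoment_le AblowitzLadik.eq_of_circleMoment_eq
  have hconv : AblowitzLadik.IsConvexOnProb J := fun μ ν κ a b hab hκ =>
    hsup.convex hJ AblowitzLadik.continuous_circleMoment AblowitzLadik.norm_circleMoment_le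
      AblowitzLadik.eq_of_circleMoment_eq a.2 b.2 (by exact_mod_cast hab)
      (AblowitzLadik.circleMoment_convex hκ)
  refine ⟨AblowitzLadik.gibbs_zero hβ, J, hJ.isGoodRateFunction hJ.nonneg, hconv,
    hJ.satisfiesLDP, fun J' hgood hLDP => (hLDP.isLocalRate hgood).unique hJ, fun V hV => ?_⟩
  obtain ⟨c, hc⟩ := AblowitzLadik.exists_iInf_freeEnergy_eq hJ.nonneg hJ.exists_ne_top hV
  have hV' : AblowitzLadik.IsLocalRate (AblowitzLadik.gibbs β V) AblowitzLadik.laxEmpirical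
      (AblowitzLadik.tiltedRate J V) := by
    have h := (AblowitzLadik.isLocalRate_smul_gibbsUnnormalised hβ hJ hV).normalise hc
    simp only [← AblowitzLadik.gibbs_eq_inv_smul hβ] at h
    exact h
  exact ⟨fun N _ => AblowitzLadik.isProbabilityMeasure_gibbs hβ hV N,
    hV'.isGoodRateFunction (AblowitzLadik.tiltedRate_nonneg hc),
    AblowitzLadik.isConvexOnProb_tiltedRate hconv hV hc, hV'.satisfiesLDP⟩
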